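/- **Theorem (The honest experimentalist).** Let $H$ be a complex Hilbert space of finite dimension $n\ge 3$. For each density operator $\sigma$ on $H$ let $\{|g_i(\sigma)\rangle\}_{i=1}^n$ be an orthonormal basis depending only on $\sigma$, and let $R_1,\dots,R_n:[0,1]\to[-\infty,\infty)$ be payment functions. When the true state is $\rho$ and the report is $\sigma$, the basis attached to $\sigma$ is measured and outcome $i$ is paid according to its reported probability, so that the expected reward is $$\overline R(\rho:\sigma)=\sum_{i=1}^n p_i\,R_i(s_i),\qquad p_i=\langle g_i(\sigma)|\rho|g_i(\sigma)\rangle,\quad s_i=\langle g_i(\sigma)|\sigma|g_i(\sigma)\rangle,$$ with the convention $0\cdot(-\infty)=0$. Suppose that, in whatever way the elements of each basis are numbered by $1,\dots,n$ (the numbering may depend on $\sigma$), $\overline R(\rho:\sigma)\le\overline R(\rho:\rho)$ for all density operators $\rho,\sigma$, with equality if and only if $\rho=\sigma$. Then, for every $\sigma$, the basis $\{|g_i(\sigma)\rangle\}$ diagonalizes $\sigma$, and there are real constants $C$ and $D>0$, independent of $i$, such that for all $i$ $$R_i(s)=C+D\ln s\qquad(0\le s<1),$$ where $\ln 0=-\infty$.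 Moreover $R_i(1)\ge C$, with $R_i(1)=C$ if $R_i$ is left-continuous at $1$. Finally, for every $\rho$ that is not pure and every $\sigma$, the expected loss from reporting $\sigma$ is $$\overline R(\rho:\rho)-\overline R(\rho:\sigma)=D\cdot S(\rho\|\sigma),$$ where $S(\rho\|\sigma)=\mathrm{Tr}(\rho\ln\rho-\rho\ln\sigma)$ is the quantum relative entropy, equal to $+\infty$ unless the support of $\rho$ is contained in that of $\sigma$. -/

import Mathlib

/-- A density operator on the Hilbert space `H`: a positive operator of trace one. -/
structure DensityOperator (H : Type*) [NormedAddCommGroup H] [InnerProductSpace ℂ H] where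
  /-- The underlying operator. -/
  op : H →L[ℂ] H
  pos : op.IsPositive
  trace_eq_one : LinearMap.trace ℂ H (op : H →ₗ[ℂ] H) = 1

/-- The probability `⟨bᵢ| ρ |bᵢ⟩` of outcome `i` when `ρ` is measured in the orthonormal
basis `b`. -/
noncomputable def outcomeProb {H : Type*} [NormedAddCommGroup H] [InnerProductSpace ℂ H] {n : ℕ}
    (b : OrthonormalBasis (Fin n) ℂ H) (ρ : DensityOperator H) (i : Fin n) : ℝ :=
  Complex.re (inner ℂ (b i) (ρ.op (b i)))

/-- Alice's expected reward for reporting `σ` when the true state is `ρ`: Bob measures `ρ` in the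
basis `g σ` attached to the report, and outcome `i` pays `R i sᵢ`, where `sᵢ` is the probability
that the report assigns to that outcome. Rewards may be `-∞`; an outcome of probability `0` that
pays `-∞` contributes `0 * ⊥ = 0`. -/
noncomputable def expectedReward {H : Type*} [NormedAddCommGroup H] [InnerProductSpace ℂ H] {n : ℕ}
    (g : DensityOperator H → OrthonormalBasis (Fin n) ℂ H) (R : Fin n → ℝ → EReal)
    (ρ σ : DensityOperator H) : EReal :=
  ∑ i, (outcomeProb (g σ) ρ i : EReal) * R i (outcomeProb (g σ) σ i)

/-- The expected reward is maximized by the honest report, and only by it. -/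
def EnsuresHonesty {H : Type*} [NormedAddCommGroup H] [InnerProductSpace ℂ H] {n : ℕ}
    (g : DensityOperator H → OrthonormalBasis (Fin n) ℂ H) (R : Fin n → ℝ → EReal) : Prop :=
  ∀ ρ σ : DensityOperator H,
    expectedReward g R ρ σ ≤ expectedReward g R ρ ρ ∧
      (expectedReward g R ρ σ = expectedReward g R ρ ρ ↔ ρ = σ)

/-- The measured basis `g σ`, with its elements listed in the order prescribed by `π σ`. -/
noncomputable def relabel {H : Type*} [NormedAddCommGroup H] [InnerProductSpace ℂ H] {n : ℕ}
    (g : DensityOperator H → OrthonormalBasis (Fin n) ℂ H)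
    (π : DensityOperator H → Equiv.Perm (Fin n)) (σ : DensityOperator H) :
    OrthonormalBasis (Fin n) ℂ H :=
  (g σ).reindex (π σ)

/-- The orthonormal basis `b` diagonalizes `σ`. -/
def Diagonalizes {H : Type*} [NormedAddCommGroup H] [InnerProductSpace ℂ H] {n : ℕ}
    (b : OrthonormalBasis (Fin n) ℂ H) (σ : DensityOperator H) : Prop :=
  ∀ i, ∃ c : ℂ, σ.op (b i) = c • b i

/-- A density operator is pure if it is a projection (of rank one, since its trace is one). -/
def DensityOperator.IsPure {H : Type*} [NormedAddCommGroup H] [InnerProductSpace ℂ H]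
    (ρ : DensityOperator H) : Prop :=
  ρ.op * ρ.op = ρ.op

open scoped Classical in
/-- The quantum relative entropy `Tr (ρ ln ρ - ρ ln σ)`, which is `+∞` unless the support of `ρ`
lies in that of `σ`. In the first case the value that `ln` takes at `0` is immaterial. -/
noncomputable def quantumRelativeEntropy {H : Type*} [NormedAddCommGroup H]
    [InnerProductSpace ℂ H] [CompleteSpace H] (ρ σ : DensityOperator H) : EReal :=
  if ∀ v, σ.op v = 0 → ρ.op v = 0 then
    ((Complex.re (LinearMap.trace ℂ H
      ((ρ.op * CFC.log ρ.op - ρ.op * CFC.log σ.op : H →L[ℂ] H) : H →ₗ[ℂ] H)) : ℝ) : EReal)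
  else ⊤

/-!
Extend the reward to the best payoff `M ρ`, the largest expected reward that any report, numbered
at will, brings in the state `ρ`. On states of full rank every reward is finite, `M` is a maximum
of functionals linear in `ρ`, hence convex and continuous (`HonestOnPosDef.convexOn_bestPayoff`),
and strict honesty says that the functional belonging to a report `σ` touches `M` at `σ` only.

*Eigenbases.* The unitary orbit of a full rank state is compact, so `M` has a maximum `τ` on it.
The functional of `τ` sees only the diagonal of a state in the basis `g τ`, and reflecting `τ` in a
vector of that basis keeps the diagonal and the orbit; by strictness the reflected state is `τ`, so
that `g τ` diagonalizes `τ` (`HonestOnPosDef.diagonalizes_of_max`). Hence `M` at any full rank state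
is at most the payoff of an honest report with the same spectrum `p`, which depends on `p` alone.
If `g σ` did not diagonalize `σ`, let `σ'` be the diagonal part of `σ` in `g σ`. Then
`M σ < M σ'` by strictness, while the bound just found gives `M σ' ≤ M σ`, since the spectrum of
`σ'` is the outcome distribution of `σ` (`HonestOnPosDef.diagonalizes`).

*The logarithm.* The payments therefore form a strictly proper scoring rule on all distributions
with positive entries. Moving probability `d` between two of at least three outcomes yields
`s Δr_i ≤ (q + d) Δr_j` and `q Δr_j ≤ (s + d) Δr_i` for the increments of `r_i` at `s` and of `r_j`
at `q`. So the payments are monotone, hence differentiable somewhere, hence everywhere, and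
`s r_i'(s) = q r_j'(q)` is a constant `D` (`IsProperScoring.eq_log`). Permuting the payments shows
that the additive constants agree.

*Singular states.* With logarithmic payments the honest reward is a decreasing function of the
entropy of the outcomes, so Jensen's inequality replaces the compactness argument and gives
eigenbases for all states (`diagonalizes_of_reward_eq_log`). The values at `0` and `1` follow by
comparing distributions close to the boundary of the simplex, and the loss formula by evaluating
both traces in eigenbases.
-/

/-! ### Density operators in an orthonormal basis -/

section States

variable {H : Type*} [NormedAddCommGroup H] [InnerProductSpace ℂ H] {n : ℕ}

theorem DensityOperator.ext_op {ρ σ : DensityOperator H} (h : ρ.op = σ.op) : ρ = σ := by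
  cases ρ; cases σ; cases h; rfl

theorem DensityOperator.ext_basis (b : OrthonormalBasis (Fin n) ℂ H) {ρ σ : DensityOperator H}
    (h : ∀ i, ρ.op (b i) = σ.op (b i)) : ρ = σ := by
  apply DensityOperator.ext_op
  have : (ρ.op : H →ₗ[ℂ] H) = (σ.op : H →ₗ[ℂ] H) :=
    b.toBasis.ext fun i => by simpa using h i
  exact ContinuousLinearMap.coe_injective this

theorem outcomeProb_nonneg (b : OrthonormalBasis (Fin n) ℂ H) (ρ : DensityOperator H) (i : Fin n) :
    0 ≤ outcomeProb b ρ i :=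
  ρ.pos.re_inner_nonneg_right (b i)

theorem sum_outcomeProb (b : OrthonormalBasis (Fin n) ℂ H) (ρ : DensityOperator H) :
    ∑ i, outcomeProb b ρ i = 1 := by
  have h := ρ.trace_eq_one
  rw [LinearMap.trace_eq_sum_inner _ b] at h
  have := congrArg Complex.re h
  simpa [outcomeProb] using this

theorem outcomeProb_le_one (b : OrthonormalBasis (Fin n) ℂ H) (ρ : DensityOperator H)
    (i : Fin n) : outcomeProb b ρ i ≤ 1 := by
  rw [← sum_outcomeProb b ρ]
  exact Finset.single_le_sum (fun j _ => outcomeProb_nonneg b ρ j) (Finset.mem_univ i)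

theorem outcomeProb_reindex (b : OrthonormalBasis (Fin n) ℂ H) (a : Equiv.Perm (Fin n))
    (ρ : DensityOperator H) (i : Fin n) :
    outcomeProb (b.reindex a) ρ i = outcomeProb b ρ (a.symm i) := by
  simp [outcomeProb]

/-- The Cauchy–Schwarz inequality for the positive form `⟨·, ρ ·⟩`, in the degenerate case. -/
theorem op_eq_zero_of_inner_re_eq_zero (ρ : DensityOperator H) (v : H)
    (h : Complex.re (inner ℂ v (ρ.op v)) = 0) : ρ.op v = 0 := by
  by_contra hne
  -- Test positivity on `v - t ρ v` for small real `t`.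
  set w := ρ.op v with hw
  have key : ∀ t : ℝ, 0 ≤ -2 * t * ‖w‖ ^ 2 + t ^ 2 * Complex.re (inner ℂ w (ρ.op w)) := by
    intro t
    have h0 := ρ.pos.re_inner_nonneg_right (v - (t : ℂ) • w)
    have h1 : inner ℂ v (ρ.op w) = inner ℂ w w := by
      rw [← ρ.pos.inner_left_eq_inner_right]
    have h2 : inner ℂ w (ρ.op v) = inner ℂ w w := rfl
    simp only [map_sub, map_smul, inner_sub_left, inner_sub_right, inner_smul_left,
      inner_smul_right, h1, h2] at h0
    have h3 : inner ℂ w w = ((‖w‖ ^ 2 : ℝ) : ℂ) := by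
      rw [inner_self_eq_norm_sq_to_K]; norm_cast
    simp only [h3, Complex.conj_ofReal] at h0
    simp [-Complex.ofReal_pow] at h0
    rw [← hw] at h0
    nlinarith [h0, h]
  have hpos : 0 < ‖w‖ ^ 2 := by have := norm_pos_iff.2 hne; positivity
  set K := Complex.re (inner ℂ w (ρ.op w)) with hK
  have hK0 : 0 ≤ K := ρ.pos.re_inner_nonneg_right w
  have := key (‖w‖ ^ 2 / (K + 1))
  have hK1 : 0 < K + 1 := by linarith
  have e : -2 * (‖w‖ ^ 2 / (K + 1)) * ‖w‖ ^ 2 + (‖w‖ ^ 2 / (K + 1)) ^ 2 * K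
      = -((‖w‖ ^ 2) ^ 2 * (K + 2) / (K + 1) ^ 2) := by field_simp; ring
  rw [e] at this
  have : 0 < (‖w‖ ^ 2) ^ 2 * (K + 2) / (K + 1) ^ 2 := by positivity
  linarith

/-- The density operator `∑ᵢ pᵢ |bᵢ⟩⟨bᵢ|` with eigenbasis `b` and spectrum `p`. -/
noncomputable def diagState (b : OrthonormalBasis (Fin n) ℂ H) (p : Fin n → ℝ)
    (hp : p ∈ stdSimplex ℝ (Fin n)) : DensityOperator H where
  op := ∑ i, (p i : ℂ) • InnerProductSpace.rankOne ℂ (b i) (b i)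
  pos := ContinuousLinearMap.isPositive_sum _ fun i _ =>
    (InnerProductSpace.isPositive_rankOne_self (b i)).smul_of_nonneg
      (Complex.zero_le_real.2 (hp.1 i))
  trace_eq_one := by
    rw [LinearMap.trace_eq_sum_inner _ b]
    simp only [ContinuousLinearMap.coe_coe, sum_apply,
      smul_apply, InnerProductSpace.rankOne_apply, inner_sum,
      inner_smul_right, b.inner_eq_ite]
    simp
    exact_mod_cast hp.2

theorem diagState_op_apply (b : OrthonormalBasis (Fin n) ℂ H) (p : Fin n → ℝ)
    (hp : p ∈ stdSimplex ℝ (Fin n)) (v : H) :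
    (diagState b p hp).op v = ∑ i, (p i : ℂ) • (inner ℂ (b i) v • b i) := by
  simp [diagState]

theorem diagState_op_basis (b : OrthonormalBasis (Fin n) ℂ H) (p : Fin n → ℝ)
    (hp : p ∈ stdSimplex ℝ (Fin n)) (j : Fin n) :
    (diagState b p hp).op (b j) = (p j : ℂ) • b j := by
  simp [diagState_op_apply, b.inner_eq_ite]

theorem diagonalizes_diagState (b : OrthonormalBasis (Fin n) ℂ H) (p : Fin n → ℝ)
    (hp : p ∈ stdSimplex ℝ (Fin n)) : Diagonalizes b (diagState b p hp) :=
  fun i => ⟨p i, diagState_op_basis b p hp i⟩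

theorem inner_diagState (b : OrthonormalBasis (Fin n) ℂ H) (p : Fin n → ℝ)
    (hp : p ∈ stdSimplex ℝ (Fin n)) (v : H) :
    Complex.re (inner ℂ v ((diagState b p hp).op v)) = ∑ i, p i * ‖inner ℂ (b i) v‖ ^ 2 := by
  rw [diagState_op_apply, inner_sum, Complex.re_sum]
  refine Finset.sum_congr rfl fun i _ => ?_
  rw [inner_smul_right, inner_smul_right, Complex.re_ofReal_mul]
  congr 1
  rw [← inner_conj_symm v (b i), Complex.mul_conj, Complex.ofReal_re, Complex.normSq_eq_norm_sq]

theorem outcomeProb_diagState (b e : OrthonormalBasis (Fin n) ℂ H) (p : Fin n → ℝ)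
    (hp : p ∈ stdSimplex ℝ (Fin n)) (j : Fin n) :
    outcomeProb e (diagState b p hp) j = ∑ i, p i * ‖inner ℂ (b i) (e j)‖ ^ 2 :=
  inner_diagState b p hp (e j)

theorem outcomeProb_diagState_self (b : OrthonormalBasis (Fin n) ℂ H) (p : Fin n → ℝ)
    (hp : p ∈ stdSimplex ℝ (Fin n)) (j : Fin n) :
    outcomeProb b (diagState b p hp) j = p j := by
  simp [outcomeProb_diagState, b.inner_eq_ite, apply_ite]

theorem outcomeProb_mem_stdSimplex (b : OrthonormalBasis (Fin n) ℂ H) (ρ : DensityOperator H) :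
    outcomeProb b ρ ∈ stdSimplex ℝ (Fin n) :=
  ⟨outcomeProb_nonneg b ρ, sum_outcomeProb b ρ⟩

theorem Diagonalizes.op_apply {b : OrthonormalBasis (Fin n) ℂ H} {σ : DensityOperator H}
    (h : Diagonalizes b σ) (i : Fin n) : σ.op (b i) = (outcomeProb b σ i : ℂ) • b i := by
  obtain ⟨c, hc⟩ := h i
  have h1 : inner ℂ (b i) (σ.op (b i)) = c := by
    simp [hc]
  have h2 := σ.pos.inner_left_eq_inner_right (b i) (b i)
  have h3 : ((c.re : ℝ) : ℂ) = c := by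
    rw [h1, hc, inner_smul_left] at h2
    exact Complex.conj_eq_iff_re.1 (by simpa using h2)
  rw [outcomeProb, h1, h3, hc]

/-- Two eigenbases list the same spectrum up to order: since their transition matrix has nonzero
determinant, some permutation picks only nonzero entries of it, and a nonzero entry forces the two
eigenvalues concerned to agree. -/
theorem Diagonalizes.exists_perm {b e : OrthonormalBasis (Fin n) ℂ H} {σ : DensityOperator H}
    (hb : Diagonalizes b σ) (he : Diagonalizes e σ) :
    ∃ a : Equiv.Perm (Fin n), ∀ i, outcomeProb b σ (a i) = outcomeProb e σ i := by
  have hdet : (b.toBasis.toMatrix e.toBasis).det ≠ 0 := by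
    have h := congrArg Matrix.det (b.toBasis.toMatrix_mul_toMatrix_flip e.toBasis)
    rw [Matrix.det_mul, Matrix.det_one] at h
    exact left_ne_zero_of_mul_eq_one h
  rw [Matrix.det_apply] at hdet
  obtain ⟨a, -, ha⟩ := Finset.exists_ne_zero_of_sum_ne_zero hdet
  refine ⟨a, fun i => ?_⟩
  have h1 : ∏ i, b.toBasis.toMatrix e.toBasis (a i) i ≠ 0 := by
    intro h0
    rw [h0] at ha
    simp at ha
  have h2 := (Finset.prod_ne_zero_iff.1 h1) i (Finset.mem_univ i)
  have h3 : inner ℂ (b (a i)) (e i) ≠ 0 := by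
    simpa [Module.Basis.toMatrix_apply, OrthonormalBasis.repr_apply_apply] using h2
  have h4 := σ.pos.inner_left_eq_inner_right (b (a i)) (e i)
  rw [hb.op_apply, he.op_apply, inner_smul_left, inner_smul_right, Complex.conj_ofReal] at h4
  exact_mod_cast mul_right_cancel₀ h3 h4

end States

/-! ### Strictly proper scoring rules paying by the reported probability -/

section ScoringRules

open Filter Topology Set

variable {n : ℕ}

/-- A family of real payments `r` is honest for classical distributions with positive
probabilities, even when the payments of the honest and of the dishonest report are numbered
differently. -/
def IsProperScoring (r : Fin n → ℝ → ℝ) : Prop :=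
  ∀ p s : Fin n → ℝ, (∀ i, 0 < p i) → (∀ i, 0 < s i) → ∑ i, p i = 1 → ∑ i, s i = 1 → p ≠ s →
    ∀ a b : Equiv.Perm (Fin n), ∑ i, p i * r (b i) (s i) < ∑ i, p i * r (a i) (p i)

theorem sum_eq_add_add_sum_erase {i j : Fin n} (hij : i ≠ j) (f : Fin n → ℝ) :
    ∑ k, f k = f i + f j + ∑ k ∈ (Finset.univ.erase i).erase j, f k := by
  rw [add_assoc, Finset.add_sum_erase _ _ (by simp [hij.symm]),
    Finset.add_sum_erase _ _ (Finset.mem_univ i)]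

/-- Comparing two distributions that differ in the entries `i` and `j` only. -/
theorem IsProperScoring.pair {r : Fin n → ℝ → ℝ} (hr : IsProperScoring r) (hn : 3 ≤ n)
    {i j : Fin n} (hij : i ≠ j) (b : Equiv.Perm (Fin n)) (hb : ∀ k, k ≠ i → k ≠ j → b k = k)
    {x y x' y' : ℝ} (hx : 0 < x) (hy : 0 < y) (hx' : 0 < x') (hy' : 0 < y')
    (hsum : x + y = x' + y') (hlt : x + y < 1) (hne : x ≠ x') :
    x * r (b i) x' + y * r (b j) y' < x * r i x + y * r j y := by
  have hn2 : (0 : ℝ) < (n : ℝ) - 2 := by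
    have : (3 : ℝ) ≤ n := by exact_mod_cast hn
    linarith
  set z : ℝ := (1 - (x + y)) / (n - 2) with hz
  have hz0 : 0 < z := div_pos (by linarith) hn2
  let P : ℝ → ℝ → Fin n → ℝ := fun u v k => if k = i then u else if k = j then v else z
  have Pi : ∀ u v, P u v i = u := fun u v => by simp [P]
  have Pj : ∀ u v, P u v j = v := fun u v => by simp [P, hij.symm]
  have Pk : ∀ u v k, k ∈ (Finset.univ.erase i).erase j → P u v k = z := by
    intro u v k hk
    simp only [Finset.mem_erase, Finset.mem_univ, and_true] at hk
    simp [P, hk.1, hk.2]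
  have Ppos : ∀ u v, 0 < u → 0 < v → ∀ k, 0 < P u v k := by
    intro u v hu hv k
    simp only [P]
    split_ifs <;> assumption
  have hcard : (((Finset.univ.erase i).erase j).card : ℝ) = n - 2 := by
    rw [Finset.card_erase_of_mem (by simp [hij.symm]), Finset.card_erase_of_mem (by simp)]
    simp only [Finset.card_univ, Fintype.card_fin]
    rw [Nat.sub_sub, Nat.cast_sub (by omega)]
    norm_num
  have Psum : ∀ u v, u + v = x + y → ∑ k, P u v k = 1 := by
    intro u v huv
    rw [sum_eq_add_add_sum_erase hij, Pi, Pj, Finset.sum_congr rfl (Pk u v), Finset.sum_const,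
      nsmul_eq_mul, hcard, huv, hz]
    field_simp
    ring
  have h := hr (P x y) (P x' y') (Ppos _ _ hx hy) (Ppos _ _ hx' hy') (Psum _ _ rfl)
    (Psum _ _ hsum.symm) (fun h => hne (by rw [← Pi x y, h, Pi])) 1 b
  rw [sum_eq_add_add_sum_erase hij, sum_eq_add_add_sum_erase hij] at h
  simp only [Pi, Pj, Equiv.Perm.one_apply] at h
  have hrest : ∑ k ∈ (Finset.univ.erase i).erase j, P x y k * r (b k) (P x' y' k)
      = ∑ k ∈ (Finset.univ.erase i).erase j, P x y k * r k (P x y k) := by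
    refine Finset.sum_congr rfl fun k hk => ?_
    rw [Pk _ _ k hk, Pk _ _ k hk]
    simp only [Finset.mem_erase, Finset.mem_univ, and_true] at hk
    rw [hb k hk.2 hk.1]
  rw [hrest] at h
  linarith

/-- Moving probability `d` between the outcomes `i` and `j` in either direction bounds the
increments of the two payments in terms of each other. -/
theorem IsProperScoring.increments {r : Fin n → ℝ → ℝ} (hr : IsProperScoring r) (hn : 3 ≤ n)
    {i j : Fin n} (hij : i ≠ j) {s q d : ℝ} (hs : 0 < s) (hq : 0 < q) (hd : 0 < d)
    (hlt : s + q + d < 1) :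
    q * (r j (q + d) - r j q) < (s + d) * (r i (s + d) - r i s) ∧
      s * (r i (s + d) - r i s) < (q + d) * (r j (q + d) - r j q) := by
  have h1 := hr.pair hn hij 1 (fun _ _ _ => rfl) (x := s + d) (y := q) (x' := s) (y' := q + d)
    (by linarith) hq hs (by linarith) (by ring) (by linarith) (by linarith)
  have h2 := hr.pair hn hij 1 (fun _ _ _ => rfl) (x := s) (y := q + d) (x' := s + d) (y' := q)
    hs (by linarith) (by linarith) hq (by ring) (by linarith) (by linarith)
  simp only [Equiv.Perm.one_apply] at h1 h2
  constructor <;> linarith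

theorem exists_ne_ne (hn : 3 ≤ n) (i k : Fin n) : ∃ l, l ≠ i ∧ l ≠ k := by
  have : ({i, k} : Finset (Fin n)).card < Fintype.card (Fin n) := by
    rw [Fintype.card_fin]
    exact lt_of_le_of_lt Finset.card_le_two (by omega)
  obtain ⟨l, -, hl⟩ := Finset.exists_mem_notMem_of_card_lt_card
    (s := {i, k}) (t := Finset.univ) (by simpa using this)
  exact ⟨l, by simpa using hl⟩

theorem IsProperScoring.strictMonoOn {r : Fin n → ℝ → ℝ} (hr : IsProperScoring r) (hn : 3 ≤ n)
    (i : Fin n) : StrictMonoOn (r i) (Ioo 0 1) := by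
  intro s hs s' hs' hlt
  obtain ⟨j, hj, -⟩ := exists_ne_ne hn i i
  obtain ⟨h1, h2⟩ := hr.increments hn hj.symm hs.1 (q := (1 - s') / 2) (d := s' - s)
    (by linarith [hs'.2]) (by linarith) (by linarith [hs'.2])
  have e : s + (s' - s) = s' := by ring
  rw [e] at h1 h2
  set u := r i s' - r i s with hu
  set q := (1 - s') / 2 with hq
  set v := r j (q + (s' - s)) - r j q
  have hq0 : 0 < q := by rw [hq]; linarith [hs'.2]
  have hs0 := hs.1
  by_contra hcon
  have hu0 : u ≤ 0 := by rw [hu]; linarith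
  have hv0 : v < 0 := by
    have : q * v < 0 := lt_of_lt_of_le h1 (mul_nonpos_of_nonneg_of_nonpos hs'.1.le hu0)
    nlinarith
  -- `s u < (q + d) v` and `q v < (s + d) u` contradict each other for negative `u`, `v`.
  nlinarith [mul_lt_mul_of_pos_left h1 hs0, mul_lt_mul_of_pos_left h2 hs'.1,
    mul_neg_of_pos_of_neg hq0 hv0, mul_pos hs0 (sub_pos.2 hlt), mul_pos hs0 hq0,
    mul_neg_of_pos_of_neg (mul_pos hq0 (sub_pos.2 hlt)) hv0,
    mul_neg_of_pos_of_neg (mul_pos (sub_pos.2 hlt) (sub_pos.2 hlt)) hv0,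
    mul_neg_of_pos_of_neg (mul_pos hs0 (sub_pos.2 hlt)) hv0]

theorem IsProperScoring.exists_differentiableAt {r : Fin n → ℝ → ℝ} (hr : IsProperScoring r)
    (hn : 3 ≤ n) (i : Fin n) {ε : ℝ} (hε : 0 < ε) (hε1 : ε < 1) :
    ∃ q, 0 < q ∧ q < ε ∧ DifferentiableAt ℝ (r i) q := by
  have hae := (hr.strictMonoOn hn i).monotoneOn.ae_differentiableWithinAt_of_mem
  by_contra! hcon
  have hsub : Ioo 0 ε ⊆ {x | ¬ (x ∈ Ioo (0:ℝ) 1 → DifferentiableWithinAt ℝ (r i) (Ioo 0 1) x)} := by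
    intro x hx hx'
    have hmem : x ∈ Ioo (0:ℝ) 1 := ⟨hx.1, hx.2.trans hε1⟩
    exact hcon x hx.1 hx.2 ((hx' hmem).differentiableAt (isOpen_Ioo.mem_nhds hmem))
  have h0 := MeasureTheory.measure_mono_null hsub hae
  rw [Real.volume_Ioo] at h0
  simp at h0
  linarith

/-- The increments of `r i` at `s` are squeezed by those of `r j` at `q`, so that a derivative of
`r j` at `q` yields one of `r i` at `s`, with `s * r i' s = q * r j' q`. -/
theorem IsProperScoring.hasDerivAt {r : Fin n → ℝ → ℝ} (hr : IsProperScoring r) (hn : 3 ≤ n)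
    {i j : Fin n} (hij : i ≠ j) {s q m : ℝ} (hs : 0 < s) (hq : 0 < q) (hlt : s + q < 1)
    (hm : HasDerivAt (r j) m q) : HasDerivAt (r i) (q * m / s) s := by
  rw [hasDerivAt_iff_tendsto_slope_zero] at hm ⊢
  have hid : Tendsto (fun t : ℝ => t) (𝓝[≠] 0) (𝓝 0) := tendsto_nhdsWithin_of_tendsto_nhds tendsto_id
  set A : ℝ → ℝ := fun t => t⁻¹ • (r j (q + t) - r j q) with hA
  set B : ℝ → ℝ := fun t => t⁻¹ • (r i (s + t) - r i s) with hB
  have hL : Tendsto (fun t => q * A t / (s + t)) (𝓝[≠] 0) (𝓝 (q * m / s)) := by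
    have := (hm.const_mul q).div (hid.const_add s) (by simpa using hs.ne')
    rwa [add_zero] at this
  have hU : Tendsto (fun t => (q + t) * A t / s) (𝓝[≠] 0) (𝓝 (q * m / s)) := by
    have := ((hid.const_add q).mul hm).div_const s
    simpa using this
  have hmin := hL.min hU
  have hmax := hL.max hU
  rw [min_self] at hmin
  rw [max_self] at hmax
  have hev : ∀ᶠ t : ℝ in 𝓝[≠] 0, t ≠ 0 ∧ 0 < s + t ∧ 0 < q + t ∧ s + q + t < 1 := by
    have h1 : ∀ᶠ t : ℝ in 𝓝[≠] 0, 0 < s + t :=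
      (hid.const_add s).eventually (lt_mem_nhds (by simpa using hs))
    have h2 : ∀ᶠ t : ℝ in 𝓝[≠] 0, 0 < q + t :=
      (hid.const_add q).eventually (lt_mem_nhds (by simpa using hq))
    have h3 : ∀ᶠ t : ℝ in 𝓝[≠] 0, s + q + t < 1 :=
      (hid.const_add (s + q)).eventually (gt_mem_nhds (by simpa using hlt))
    filter_upwards [self_mem_nhdsWithin, h1, h2, h3] with t h0 h1 h2 h3
    exact ⟨h0, h1, h2, h3⟩
  have hAe : ∀ t : ℝ, t ≠ 0 → r j (q + t) - r j q = t * A t := fun t ht => by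
    simp only [hA, smul_eq_mul]; field_simp
  have hBe : ∀ t : ℝ, t ≠ 0 → r i (s + t) - r i s = t * B t := fun t ht => by
    simp only [hB, smul_eq_mul]; field_simp
  refine tendsto_of_tendsto_of_tendsto_of_le_of_le' hmin hmax ?_ ?_
  all_goals
    filter_upwards [hev] with t ⟨h0, h1, h2, h3⟩
    have eA := hAe t h0
    have eB := hBe t h0
    rcases lt_or_gt_of_ne h0 with hneg | hpos
    · obtain ⟨k1, k2⟩ := hr.increments hn hij h1 h2 (neg_pos.2 hneg) (by linarith)
      rw [add_neg_cancel_right, add_neg_cancel_right] at k1 k2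
      have k1' : (q + t) * A t ≤ s * B t := by nlinarith
      have k2' : (s + t) * B t ≤ q * A t := by nlinarith
      first
        | exact (min_le_right _ _).trans (by rw [div_le_iff₀ hs]; linarith)
        | exact le_trans (by rw [le_div_iff₀ h1]; linarith) (le_max_left _ _)
    · obtain ⟨k1, k2⟩ := hr.increments hn hij hs hq hpos (by linarith)
      have k1' : q * A t ≤ (s + t) * B t := by nlinarith
      have k2' : s * B t ≤ (q + t) * A t := by nlinarith
      first
        | exact (min_le_left _ _).trans (by rw [div_le_iff₀ h1]; linarith)
        | exact le_trans (by rw [le_div_iff₀ hs]; linarith) (le_max_right _ _)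

/-- A scoring rule on at least three outcomes that is honest and pays according to the
reported probability of the observed outcome is logarithmic. -/
theorem IsProperScoring.eq_log {r : Fin n → ℝ → ℝ} (hr : IsProperScoring r) (hn : 3 ≤ n) :
    ∃ C D : ℝ, 0 < D ∧ ∀ i, ∀ x ∈ Ioo (0 : ℝ) 1, r i x = C + D * Real.log x := by
  have hdiff : ∀ i, ∀ s ∈ Ioo (0 : ℝ) 1, DifferentiableAt ℝ (r i) s := by
    intro i s hs
    obtain ⟨j, hj, -⟩ := exists_ne_ne hn i i
    obtain ⟨q, hq, hq', hd⟩ := hr.exists_differentiableAt hn j (ε := 1 - s)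
      (by linarith [hs.2]) (by linarith [hs.1])
    exact (hr.hasDerivAt hn hj.symm hs.1 hq (by linarith) hd.hasDerivAt).differentiableAt
  have hconst : ∀ i k, ∀ s ∈ Ioo (0 : ℝ) 1, ∀ u ∈ Ioo (0 : ℝ) 1,
      s * deriv (r i) s = u * deriv (r k) u := by
    intro i k s hs u hu
    obtain ⟨l, hl, hl'⟩ := exists_ne_ne hn i k
    obtain ⟨q, hq, hqε⟩ : ∃ q, 0 < q ∧ q < min (1 - s) (1 - u) :=
      exists_between (lt_min (by linarith [hs.2]) (by linarith [hu.2]))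
    rw [lt_min_iff] at hqε
    have hd := (hdiff l q ⟨hq, by linarith [hs.1]⟩).hasDerivAt
    rw [(hr.hasDerivAt hn hl.symm hs.1 hq (by linarith) hd).deriv,
      (hr.hasDerivAt hn hl'.symm hu.1 hq (by linarith) hd).deriv]
    have := hs.1.ne'
    have := hu.1.ne'
    field_simp
  let i₀ : Fin n := ⟨0, by omega⟩
  have half : (1 / 2 : ℝ) ∈ Ioo (0 : ℝ) 1 := by constructor <;> norm_num
  have quarter : (1 / 4 : ℝ) ∈ Ioo (0 : ℝ) 1 := by constructor <;> norm_num
  set D := (1 / 2 : ℝ) * deriv (r i₀) (1 / 2) with hD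
  have hC : ∀ i, ∃ c, ∀ x ∈ Ioo (0 : ℝ) 1, r i x = c + D * Real.log x := by
    intro i
    have hder : ∀ x ∈ Ioo (0 : ℝ) 1, HasDerivAt (fun x => r i x - D * Real.log x) 0 x := by
      intro x hx
      have h1 := (hdiff i x hx).hasDerivAt.sub ((Real.hasDerivAt_log hx.1.ne').const_mul D)
      have h2 : deriv (r i) x - D * x⁻¹ = 0 := by
        rw [hD, ← hconst i i₀ x hx _ half]
        have := hx.1.ne'
        field_simp
        ring
      rwa [h2] at h1
    obtain ⟨c, hc⟩ := isOpen_Ioo.exists_is_const_of_deriv_eq_zero isPreconnected_Ioo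
      (fun x hx => (hder x hx).differentiableAt.differentiableWithinAt)
      (fun x hx => (hder x hx).deriv)
    exact ⟨c, fun x hx => by linarith [hc x hx]⟩
  choose c hc using hC
  have hc_le : ∀ i j, i ≠ j → c j ≤ c i := by
    intro i j hij
    -- Swap the payments `i` and `j` in the dishonest report, and let that report become honest.
    let F : ℝ → ℝ := fun h => D * ((1 / 2) * Real.log (1 / 2) + (1 / 4) * Real.log (1 / 4)
      - (1 / 2) * Real.log (1 / 2 + h) - (1 / 4) * Real.log (1 / 4 - h))
    have hF0 : Tendsto F (𝓝[>] 0) (𝓝 0) := by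
      have hcont : ContinuousAt F 0 := by
        have h1 : ContinuousAt (fun h : ℝ => Real.log (1 / 2 + h)) 0 :=
          ContinuousAt.log (by fun_prop) (by norm_num)
        have h2 : ContinuousAt (fun h : ℝ => Real.log (1 / 4 - h)) 0 :=
          ContinuousAt.log (by fun_prop) (by norm_num)
        fun_prop
      have : F 0 = 0 := by simp only [F, add_zero, sub_zero]; ring
      simpa [this] using hcont.tendsto.mono_left nhdsWithin_le_nhds
    have hle : ∀ᶠ h in 𝓝[>] (0 : ℝ), (1 / 4) * (c j - c i) ≤ F h := by
      filter_upwards [Ioo_mem_nhdsGT (show (0 : ℝ) < 1 / 8 by norm_num)] with h hh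
      have := hr.pair hn hij (Equiv.swap i j) (fun k hi hj => Equiv.swap_apply_of_ne_of_ne hi hj)
        (x := 1 / 2) (y := 1 / 4) (x' := 1 / 2 + h) (y' := 1 / 4 - h) (by norm_num) (by norm_num)
        (by linarith [hh.1]) (by linarith [hh.2]) (by ring) (by norm_num) (by linarith [hh.1])
      rw [Equiv.swap_apply_left, Equiv.swap_apply_right, hc i _ half, hc j _ quarter,
        hc j _ ⟨by linarith [hh.1], by linarith [hh.2]⟩,
        hc i _ ⟨by linarith [hh.2], by linarith [hh.1]⟩] at this
      simp only [F]
      linarith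
    have := ge_of_tendsto hF0 hle
    linarith
  refine ⟨c i₀, D, ?_, fun i x hx => ?_⟩
  · have h1 := hr.strictMonoOn hn i₀ quarter half (by norm_num)
    rw [hc _ _ quarter, hc _ _ half] at h1
    have h2 : Real.log (1 / 4) < Real.log (1 / 2) := Real.log_lt_log (by norm_num) (by norm_num)
    by_contra hcon
    nlinarith
  · rcases eq_or_ne i i₀ with rfl | h
    · exact hc _ x hx
    · rw [hc i x hx, le_antisymm (hc_le _ _ h.symm) (hc_le _ _ h)]

end ScoringRules

/-! ### Honest measurement schemes on positive definite states -/

section PositiveDefinite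

open Filter Topology Set

variable {H : Type*} [NormedAddCommGroup H] [InnerProductSpace ℂ H] {n : ℕ}

/-- A density operator of full rank. -/
def DensityOperator.IsPosDef (ρ : DensityOperator H) : Prop :=
  ∀ v, v ≠ 0 → 0 < Complex.re (inner ℂ v (ρ.op v))

theorem DensityOperator.IsPosDef.outcomeProb_pos {ρ : DensityOperator H} (h : ρ.IsPosDef)
    (b : OrthonormalBasis (Fin n) ℂ H) (i : Fin n) : 0 < outcomeProb b ρ i :=
  h _ (b.orthonormal.ne_zero i)

theorem exists_inner_ne_zero (b : OrthonormalBasis (Fin n) ℂ H) {v : H} (hv : v ≠ 0) :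
    ∃ i, inner ℂ (b i) v ≠ 0 := by
  by_contra! h
  exact hv (by rw [← b.sum_repr' v]; simp [h])

theorem isPosDef_diagState (b : OrthonormalBasis (Fin n) ℂ H) {p : Fin n → ℝ}
    (hp : p ∈ stdSimplex ℝ (Fin n)) (hpos : ∀ i, 0 < p i) : (diagState b p hp).IsPosDef := by
  intro v hv
  rw [inner_diagState]
  obtain ⟨i, hi⟩ := exists_inner_ne_zero b hv
  refine Finset.sum_pos' (fun j _ => mul_nonneg (hp.1 j) (sq_nonneg _)) ⟨i, Finset.mem_univ i, ?_⟩
  have := norm_pos_iff.2 hi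
  have := hpos i
  positivity

theorem re_inner_combination (A B : H →L[ℂ] H) (x y : ℝ) (v : H) :
    Complex.re (inner ℂ v ((x • A + y • B) v))
      = x * Complex.re (inner ℂ v (A v)) + y * Complex.re (inner ℂ v (B v)) := by
  have : inner ℂ v ((x • A + y • B) v) = (x : ℂ) * inner ℂ v (A v) + (y : ℂ) * inner ℂ v (B v) := by
    rw [add_apply, smul_apply, smul_apply, inner_add_right, ← Complex.coe_smul, ← Complex.coe_smul,
      inner_smul_right, inner_smul_right]
  rw [this, Complex.add_re, Complex.re_ofReal_mul, Complex.re_ofReal_mul]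

/-- The expectation of the payments `r`, numbered by `b`, that are due when `σ` is reported and
measured in the basis `e`; the operator `A` plays the role of the true state. -/
noncomputable def payoff (r : Fin n → ℝ → ℝ) (e : OrthonormalBasis (Fin n) ℂ H)
    (b : Equiv.Perm (Fin n)) (σ : DensityOperator H) (A : H →L[ℂ] H) : ℝ :=
  ∑ i, Complex.re (inner ℂ (e i) (A (e i))) * r (b i) (outcomeProb e σ i)

theorem payoff_combination (r : Fin n → ℝ → ℝ) (e : OrthonormalBasis (Fin n) ℂ H)
    (b : Equiv.Perm (Fin n)) (σ : DensityOperator H) (A B : H →L[ℂ] H) (x y : ℝ) :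
    payoff r e b σ (x • A + y • B) = x * payoff r e b σ A + y * payoff r e b σ B := by
  simp only [payoff, Finset.mul_sum, ← Finset.sum_add_distrib, re_inner_combination]
  exact Finset.sum_congr rfl fun i _ => by ring

theorem payoff_op (r : Fin n → ℝ → ℝ) (e : OrthonormalBasis (Fin n) ℂ H)
    (b : Equiv.Perm (Fin n)) (σ ρ : DensityOperator H) :
    payoff r e b σ ρ.op = ∑ i, outcomeProb e ρ i * r (b i) (outcomeProb e σ i) := rfl

/-- Among positive definite states, the honest report is strictly better than any other, however
the two measured bases are numbered. -/
def HonestOnPosDef (g : DensityOperator H → OrthonormalBasis (Fin n) ℂ H) (r : Fin n → ℝ → ℝ) :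
    Prop :=
  ∀ ρ σ : DensityOperator H, ρ.IsPosDef → σ.IsPosDef → ρ ≠ σ → ∀ a b : Equiv.Perm (Fin n),
    payoff r (g σ) b σ ρ.op < payoff r (g ρ) a ρ ρ.op

/-- The best payoff that a positive definite report, numbered at will, can achieve. -/
noncomputable def bestPayoff (g : DensityOperator H → OrthonormalBasis (Fin n) ℂ H)
    (r : Fin n → ℝ → ℝ) (A : H →L[ℂ] H) : ℝ :=
  ⨆ k : {σ : DensityOperator H // σ.IsPosDef} × Equiv.Perm (Fin n),
    payoff r (g k.1) k.2 k.1 A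

/-- The operators whose real part is bounded below by a positive constant: an open convex cone that
contains the positive definite states. -/
def accretiveCone (H : Type*) [NormedAddCommGroup H] [InnerProductSpace ℂ H] : Set (H →L[ℂ] H) :=
  {A | ∃ c : ℝ, 0 < c ∧ ∀ v, c * ‖v‖ ^ 2 ≤ Complex.re (inner ℂ v (A v))}

theorem isOpen_accretiveCone : IsOpen (accretiveCone H) := by
  rw [Metric.isOpen_iff]
  rintro A ⟨c, hc, hA⟩
  refine ⟨c / 2, by linarith, fun B hB => ⟨c / 2, by linarith, fun v => ?_⟩⟩
  rw [mem_ball_iff_norm] at hB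
  have h1 : ‖inner ℂ v ((B - A) v)‖ ≤ c / 2 * ‖v‖ ^ 2 := by
    calc ‖inner ℂ v ((B - A) v)‖ ≤ ‖v‖ * ‖(B - A) v‖ := norm_inner_le_norm _ _
      _ ≤ ‖v‖ * (‖B - A‖ * ‖v‖) := by gcongr; exact (B - A).le_opNorm v
      _ ≤ ‖v‖ * (c / 2 * ‖v‖) := by gcongr
      _ = c / 2 * ‖v‖ ^ 2 := by ring
  have h2 := (abs_le.1 ((Complex.abs_re_le_norm _).trans h1)).1
  rw [sub_apply, inner_sub_right, Complex.sub_re] at h2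
  linarith [hA v]

theorem convex_accretiveCone : Convex ℝ (accretiveCone H) := by
  rintro A ⟨c, hc, hA⟩ B ⟨d, hd, hB⟩ x y hx hy hxy
  refine ⟨min c d, lt_min hc hd, fun v => ?_⟩
  rw [re_inner_combination]
  have h1 : min c d * ‖v‖ ^ 2 ≤ Complex.re (inner ℂ v (A v)) :=
    le_trans (by gcongr; exact min_le_left _ _) (hA v)
  have h2 : min c d * ‖v‖ ^ 2 ≤ Complex.re (inner ℂ v (B v)) :=
    le_trans (by gcongr; exact min_le_right _ _) (hB v)
  calc min c d * ‖v‖ ^ 2 = x * (min c d * ‖v‖ ^ 2) + y * (min c d * ‖v‖ ^ 2) := by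
        rw [← add_mul, hxy, one_mul]
    _ ≤ _ := add_le_add (mul_le_mul_of_nonneg_left h1 hx) (mul_le_mul_of_nonneg_left h2 hy)

theorem diagState_mem_accretiveCone (hn : 0 < n) (b : OrthonormalBasis (Fin n) ℂ H) {p : Fin n → ℝ}
    (hp : p ∈ stdSimplex ℝ (Fin n)) (hpos : ∀ i, 0 < p i) :
    (diagState b p hp).op ∈ accretiveCone H := by
  have : Nonempty (Fin n) := ⟨⟨0, hn⟩⟩
  obtain ⟨i₀, hi₀⟩ := Finite.exists_min p
  refine ⟨p i₀, hpos i₀, fun v => ?_⟩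
  rw [inner_diagState, ← b.sum_sq_norm_inner_right v, Finset.mul_sum]
  exact Finset.sum_le_sum fun i _ => mul_le_mul_of_nonneg_right (hi₀ i) (sq_nonneg _)

/-- The Hermitian part of an operator in the cone is a multiple of a positive definite state. -/
theorem exists_state_of_mem_accretiveCone [CompleteSpace H] (hn : 0 < n)
    (b : OrthonormalBasis (Fin n) ℂ H) {A : H →L[ℂ] H} (hA : A ∈ accretiveCone H) :
    ∃ t : ℝ, 0 < t ∧ ∃ σ : DensityOperator H, σ.IsPosDef ∧
      ∀ v, Complex.re (inner ℂ v (A v)) = t * Complex.re (inner ℂ v (σ.op v)) := by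
  obtain ⟨c, hc, hA⟩ := hA
  set T : H →L[ℂ] H := A + A.adjoint with hT
  have hTv : ∀ v, Complex.re (inner ℂ v (T v)) = 2 * Complex.re (inner ℂ v (A v)) := by
    intro v
    rw [hT, add_apply, inner_add_right, ContinuousLinearMap.adjoint_inner_right, Complex.add_re,
      ← inner_conj_symm v (A v), Complex.conj_re]
    ring
  have hpos : T.IsPositive := by
    rw [ContinuousLinearMap.isPositive_def']
    refine ⟨?_, fun v => ?_⟩
    · rw [hT, ← ContinuousLinearMap.star_eq_adjoint]
      exact IsSelfAdjoint.add_star_self A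
    · have h1 := hTv v
      rw [← inner_conj_symm, Complex.conj_re] at h1
      change 0 ≤ Complex.re (inner ℂ (T v) v)
      rw [h1]
      have := hA v
      have : 0 ≤ c * ‖v‖ ^ 2 := by positivity
      linarith
  set t : ℝ := ∑ i, Complex.re (inner ℂ (b i) (A (b i))) with ht
  have htr : LinearMap.trace ℂ H (T : H →ₗ[ℂ] H) = ((2 * t : ℝ) : ℂ) := by
    rw [LinearMap.trace_eq_sum_inner _ b, ht, Finset.mul_sum, Complex.ofReal_sum]
    refine Finset.sum_congr rfl fun i _ => ?_
    rw [← hTv]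
    refine (Complex.conj_eq_iff_re.1 ?_).symm
    rw [inner_conj_symm]
    exact hpos.inner_left_eq_inner_right _ _
  have ht0 : 0 < t := by
    refine Finset.sum_pos (fun i _ => lt_of_lt_of_le ?_ (hA (b i))) ⟨⟨0, hn⟩, Finset.mem_univ _⟩
    simpa using hc
  refine ⟨t, ht0, ⟨((2 * t)⁻¹ : ℝ) • (T : H →L[ℂ] H), ?_, ?_⟩, ?_, ?_⟩
  · rw [← Complex.coe_smul]
    exact hpos.smul_of_nonneg (Complex.zero_le_real.2 (by positivity))
  · rw [← Complex.coe_smul, ContinuousLinearMap.toLinearMap_smul, map_smul, htr, smul_eq_mul,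
      ← Complex.ofReal_mul, inv_mul_cancel₀ (by positivity), Complex.ofReal_one]
  all_goals
    have key : ∀ v, Complex.re (inner ℂ v ((((2 * t)⁻¹ : ℝ) • T) v))
        = t⁻¹ * Complex.re (inner ℂ v (A v)) := by
      intro v
      rw [smul_apply, ← Complex.coe_smul, inner_smul_right, Complex.re_ofReal_mul, hTv]
      field_simp
    intro v
  · intro hv
    change 0 < Complex.re (inner ℂ v ((((2 * t)⁻¹ : ℝ) • T) v))
    rw [key]
    have := norm_pos_iff.2 hv
    have := hA v
    have : 0 < c * ‖v‖ ^ 2 := by positivity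
    have : 0 < t⁻¹ := inv_pos.2 ht0
    nlinarith
  · change _ = t * Complex.re (inner ℂ v ((((2 * t)⁻¹ : ℝ) • T) v))
    rw [key, mul_inv_cancel_left₀ ht0.ne']

variable {g : DensityOperator H → OrthonormalBasis (Fin n) ℂ H} {r : Fin n → ℝ → ℝ}

/-- The supremum defining `bestPayoff` at a positive definite state is attained by an honest
report. -/
theorem HonestOnPosDef.exists_isGreatest (h : HonestOnPosDef g r) {ρ : DensityOperator H}
    (hρ : ρ.IsPosDef) : ∃ a : Equiv.Perm (Fin n), ∀ σ : DensityOperator H, σ.IsPosDef →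
      ∀ b, payoff r (g σ) b σ ρ.op ≤ payoff r (g ρ) a ρ ρ.op := by
  obtain ⟨a, ha⟩ := Finite.exists_max fun a => payoff r (g ρ) a ρ ρ.op
  refine ⟨a, fun σ hσ b => ?_⟩
  by_cases hne : ρ = σ
  · subst hne; exact ha b
  · exact (h ρ σ hρ hσ hne a b).le

theorem HonestOnPosDef.exists_isGreatest_of_mem_cone [CompleteSpace H] (h : HonestOnPosDef g r)
    (hn : 0 < n) (b₀ : OrthonormalBasis (Fin n) ℂ H) {A : H →L[ℂ] H}
    (hA : A ∈ accretiveCone H) :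
    ∃ k : {σ : DensityOperator H // σ.IsPosDef} × Equiv.Perm (Fin n),
      ∀ l : {σ : DensityOperator H // σ.IsPosDef} × Equiv.Perm (Fin n),
        payoff r (g l.1) l.2 l.1 A ≤ payoff r (g k.1) k.2 k.1 A := by
  obtain ⟨t, ht, σ, hσ, hv⟩ := exists_state_of_mem_accretiveCone hn b₀ hA
  obtain ⟨a, ha⟩ := h.exists_isGreatest hσ
  have hscale : ∀ (e : OrthonormalBasis (Fin n) ℂ H) b τ, payoff r e b τ A
      = t * payoff r e b τ σ.op := by
    intro e b τ
    simp only [payoff, Finset.mul_sum, hv, mul_assoc]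
  refine ⟨⟨⟨σ, hσ⟩, a⟩, fun l => ?_⟩
  rw [hscale, hscale]
  exact mul_le_mul_of_nonneg_left (ha _ l.1.2 _) ht.le

theorem bestPayoff_eq_of_isGreatest {A : H →L[ℂ] H}
    {k : {σ : DensityOperator H // σ.IsPosDef} × Equiv.Perm (Fin n)}
    (hk : ∀ l : {σ : DensityOperator H // σ.IsPosDef} × Equiv.Perm (Fin n),
        payoff r (g l.1) l.2 l.1 A ≤ payoff r (g k.1) k.2 k.1 A) :
    bestPayoff g r A = payoff r (g k.1) k.2 k.1 A := by
  have : Nonempty ({σ : DensityOperator H // σ.IsPosDef} × Equiv.Perm (Fin n)) := ⟨k⟩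
  exact le_antisymm (ciSup_le hk)
    (le_ciSup (f := fun l : {σ : DensityOperator H // σ.IsPosDef} × Equiv.Perm (Fin n) =>
      payoff r (g l.1) l.2 l.1 A) ⟨_, by rintro _ ⟨l, rfl⟩; exact hk l⟩ k)

theorem HonestOnPosDef.convexOn_bestPayoff [CompleteSpace H] (h : HonestOnPosDef g r)
    (hn : 0 < n) (b₀ : OrthonormalBasis (Fin n) ℂ H) :
    ConvexOn ℝ (accretiveCone H) (bestPayoff g r) := by
  refine ⟨convex_accretiveCone, fun A hA B hB x y hx hy hxy => ?_⟩
  obtain ⟨k, hk⟩ := h.exists_isGreatest_of_mem_cone hn b₀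
    (convex_accretiveCone hA hB hx hy hxy)
  obtain ⟨kA, hkA⟩ := h.exists_isGreatest_of_mem_cone hn b₀ hA
  obtain ⟨kB, hkB⟩ := h.exists_isGreatest_of_mem_cone hn b₀ hB
  rw [bestPayoff_eq_of_isGreatest hk, bestPayoff_eq_of_isGreatest hkA,
    bestPayoff_eq_of_isGreatest hkB, payoff_combination]
  exact add_le_add (mul_le_mul_of_nonneg_left (hkA k) hx) (mul_le_mul_of_nonneg_left (hkB k) hy)

theorem HonestOnPosDef.exists_bestPayoff_eq (h : HonestOnPosDef g r) {ρ : DensityOperator H}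
    (hρ : ρ.IsPosDef) : ∃ a, bestPayoff g r ρ.op = payoff r (g ρ) a ρ ρ.op := by
  obtain ⟨a, ha⟩ := h.exists_isGreatest hρ
  exact ⟨a, bestPayoff_eq_of_isGreatest (k := ⟨⟨ρ, hρ⟩, a⟩) fun l => ha _ l.1.2 _⟩

theorem HonestOnPosDef.payoff_self_le_bestPayoff (h : HonestOnPosDef g r)
    {ρ : DensityOperator H} (hρ : ρ.IsPosDef) (b : Equiv.Perm (Fin n)) :
    payoff r (g ρ) b ρ ρ.op ≤ bestPayoff g r ρ.op := by
  obtain ⟨a, ha⟩ := h.exists_isGreatest hρ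
  rw [bestPayoff_eq_of_isGreatest (k := ⟨⟨ρ, hρ⟩, a⟩) fun l => ha _ l.1.2 _]
  exact ha ρ hρ b

theorem HonestOnPosDef.payoff_lt_bestPayoff (h : HonestOnPosDef g r)
    {ρ σ : DensityOperator H} (hρ : ρ.IsPosDef) (hσ : σ.IsPosDef) (hne : ρ ≠ σ)
    (b : Equiv.Perm (Fin n)) : payoff r (g σ) b σ ρ.op < bestPayoff g r ρ.op :=
  (h ρ σ hρ hσ hne 1 b).trans_le (h.payoff_self_le_bestPayoff hρ 1)

theorem isCompact_orthonormal [FiniteDimensional ℂ H] :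
    IsCompact {e : Fin n → H | Orthonormal ℂ e} := by
  have : ProperSpace H := FiniteDimensional.proper ℂ H
  refine IsCompact.of_isClosed_subset
    (isCompact_univ_pi fun _ : Fin n => isCompact_closedBall (0 : H) 1) ?_ ?_
  · simp only [orthonormal_iff_ite, Set.ofPred_forall]
    refine isClosed_iInter fun i => isClosed_iInter fun j => isClosed_eq ?_ continuous_const
    fun_prop
  · intro e he i _
    simp [he.1 i]

theorem exists_orthonormalBasis_coe_eq (b : OrthonormalBasis (Fin n) ℂ H) {e : Fin n → H}
    (he : Orthonormal ℂ e) : ∃ b' : OrthonormalBasis (Fin n) ℂ H, ⇑b' = e := by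
  have hfin : Fintype.card (Fin n) = Module.finrank ℂ H :=
    (Module.finrank_eq_card_basis b.toBasis).symm
  have : FiniteDimensional ℂ H := b.toBasis.finiteDimensional_of_finite
  exact ⟨OrthonormalBasis.mk he
    (he.linearIndependent.span_eq_top_of_card_eq_finrank' hfin).ge, OrthonormalBasis.coe_mk _ _⟩

/-- On a unitary orbit of positive definite states the best payoff attains its maximum. -/
theorem HonestOnPosDef.exists_max_on_orbit [CompleteSpace H] [FiniteDimensional ℂ H]
    (h : HonestOnPosDef g r)
    (hn : 0 < n) (b₀ : OrthonormalBasis (Fin n) ℂ H) {p : Fin n → ℝ}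
    (hp : p ∈ stdSimplex ℝ (Fin n)) (hpos : ∀ i, 0 < p i) :
    ∃ e : OrthonormalBasis (Fin n) ℂ H, ∀ b : OrthonormalBasis (Fin n) ℂ H,
      bestPayoff g r (diagState b p hp).op ≤ bestPayoff g r (diagState e p hp).op := by
  let Ψ : (Fin n → H) → (H →L[ℂ] H) :=
    fun e => ∑ i, (p i : ℂ) • InnerProductSpace.rankOne ℂ (e i) (e i)
  have hΨ : Continuous Ψ := by
    refine continuous_finsetSum _ fun i _ => ?_
    have hi : Continuous fun e : Fin n → H => InnerProductSpace.rankOne ℂ (e i) (e i) := by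
      simp only [InnerProductSpace.rankOne_def]
      fun_prop
    exact hi.const_smul (p i : ℂ)
  have hmaps : MapsTo Ψ {e : Fin n → H | Orthonormal ℂ e} (accretiveCone H) := by
    intro e he
    obtain ⟨b', rfl⟩ := exists_orthonormalBasis_coe_eq b₀ he
    exact diagState_mem_accretiveCone hn b' hp hpos
  have hcont : ContinuousOn (bestPayoff g r) (accretiveCone H) := by
    have : FiniteDimensional ℝ (H →L[ℂ] H) := FiniteDimensional.complexToReal _
    exact (h.convexOn_bestPayoff hn b₀).continuousOn isOpen_accretiveCone
  obtain ⟨e, he, hmax⟩ := isCompact_orthonormal.exists_isMaxOn ⟨b₀, b₀.orthonormal⟩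
    (hcont.comp hΨ.continuousOn hmaps)
  obtain ⟨e', rfl⟩ := exists_orthonormalBasis_coe_eq b₀ he
  exact ⟨e', fun b => hmax b.orthonormal⟩

/-- A state that maximizes the best payoff on its unitary orbit is measured in an eigenbasis:
reflecting it in an element of the measured basis leaves all outcome probabilities unchanged,
so by strict honesty the reflected state is the same state. -/
theorem HonestOnPosDef.diagonalizes_of_max (h : HonestOnPosDef g r)
    {p : Fin n → ℝ} (hp : p ∈ stdSimplex ℝ (Fin n)) (hpos : ∀ i, 0 < p i)
    {e : OrthonormalBasis (Fin n) ℂ H} (hmax : ∀ b : OrthonormalBasis (Fin n) ℂ H,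
      bestPayoff g r (diagState b p hp).op ≤ bestPayoff g r (diagState e p hp).op) :
    Diagonalizes (g (diagState e p hp)) (diagState e p hp) := by
  set τ := diagState e p hp with hτ
  have hτpos : τ.IsPosDef := isPosDef_diagState e hp hpos
  intro k
  let V : H ≃ₗᵢ[ℂ] H := (Submodule.span ℂ {g τ k}).reflection
  have hVV : ∀ v, V (V v) = v := fun v => Submodule.reflection_reflection _ v
  have hVk : V (g τ k) = g τ k :=
    Submodule.reflection_mem_subspace_eq_self (Submodule.mem_span_singleton_self _)
  have hVi : ∀ i, i ≠ k → V (g τ i) = - g τ i := by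
    intro i hi
    refine Submodule.reflection_mem_subspace_orthogonalComplement_eq_neg ?_
    rw [Submodule.mem_orthogonal_singleton_iff_inner_right]
    exact (g τ).orthonormal.2 hi.symm
  have hinner : ∀ v w, inner ℂ (V v) w = inner ℂ v (V w) := fun v w => by
    rw [← V.inner_map_map v (V w), hVV]
  set ρ := diagState (e.map V) p hp with hρ
  have hρpos : ρ.IsPosDef := isPosDef_diagState _ hp hpos
  have hprob : ∀ i, outcomeProb (g τ) ρ i = outcomeProb (g τ) τ i := by
    intro i
    rw [hρ, outcomeProb_diagState, hτ, outcomeProb_diagState, ← hτ]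
    refine Finset.sum_congr rfl fun j _ => ?_
    rw [OrthonormalBasis.map_apply, hinner]
    rcases eq_or_ne i k with rfl | hi
    · rw [hVk]
    · rw [hVi i hi, inner_neg_right, norm_neg]
  have heq : ρ = τ := by
    by_contra hne
    obtain ⟨a, ha⟩ := h.exists_bestPayoff_eq hτpos
    have h1 := h.payoff_lt_bestPayoff hρpos hτpos hne a
    have h2 : payoff r (g τ) a τ ρ.op = payoff r (g τ) a τ τ.op := by
      simp only [payoff_op, hprob]
    rw [h2, ← ha] at h1
    exact absurd (hmax (e.map V)) (not_le.2 h1)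
  have hcomm : ∀ v, τ.op (V v) = V (τ.op v) := by
    have : (τ.op : H →ₗ[ℂ] H) ∘ₗ (V.toLinearEquiv : H →ₗ[ℂ] H)
        = (V.toLinearEquiv : H →ₗ[ℂ] H) ∘ₗ (τ.op : H →ₗ[ℂ] H) := by
      refine e.toBasis.ext fun i => ?_
      have h1 : τ.op (V (e i)) = (p i : ℂ) • V (e i) := by
        have := diagState_op_basis (e.map V) p hp i
        rw [← hρ, heq, OrthonormalBasis.map_apply] at this
        exact this
      have h2 : τ.op (e i) = (p i : ℂ) • e i := diagState_op_basis e p hp i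
      simp [h1, h2, -Complex.coe_smul]
    exact fun v => LinearMap.congr_fun this v
  have hmem : τ.op (g τ k) ∈ Submodule.span ℂ {g τ k} := by
    rw [← Submodule.reflection_eq_self_iff]
    change V (τ.op (g τ k)) = _
    rw [← hcomm, hVk]
  obtain ⟨c, hc⟩ := Submodule.mem_span_singleton.1 hmem
  exact ⟨c, hc.symm⟩

/-- The best payoff at a positive definite state is bounded by the payoff that an honest report in
an eigenbasis, suitably numbered, would bring. -/
theorem HonestOnPosDef.exists_bestPayoff_le [CompleteSpace H] [FiniteDimensional ℂ H]
    (h : HonestOnPosDef g r) (hn : 0 < n) {p : Fin n → ℝ} (hp : p ∈ stdSimplex ℝ (Fin n))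
    (hpos : ∀ i, 0 < p i) (b : OrthonormalBasis (Fin n) ℂ H) :
    ∃ a : Equiv.Perm (Fin n),
      bestPayoff g r (diagState b p hp).op ≤ ∑ i, p i * r (a i) (p i) := by
  obtain ⟨e, hmax⟩ := h.exists_max_on_orbit hn b hp hpos
  obtain ⟨a, ha⟩ := h.exists_bestPayoff_eq (isPosDef_diagState e hp hpos)
  obtain ⟨c, hc⟩ := (h.diagonalizes_of_max hp hpos hmax).exists_perm (diagonalizes_diagState e p hp)
  refine ⟨c.trans a, (hmax b).trans ?_⟩
  rw [ha, payoff_op, ← Equiv.sum_comp c]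
  simp only [hc, outcomeProb_diagState_self, Equiv.trans_apply]
  exact le_rfl

theorem HonestOnPosDef.diagonalizes [CompleteSpace H] [FiniteDimensional ℂ H]
    (h : HonestOnPosDef g r) (hn : 0 < n) {σ : DensityOperator H} (hσ : σ.IsPosDef) :
    Diagonalizes (g σ) σ := by
  by_contra hnot
  set s := outcomeProb (g σ) σ with hs
  have hsim : s ∈ stdSimplex ℝ (Fin n) := outcomeProb_mem_stdSimplex _ _
  have hspos : ∀ i, 0 < s i := hσ.outcomeProb_pos (g σ)
  set σ' := diagState (g σ) s hsim with hσ'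
  have hne : σ' ≠ σ := by
    intro heq
    have := diagonalizes_diagState (g σ) s hsim
    rw [← hσ', heq] at this
    exact hnot this
  obtain ⟨a, ha⟩ := h.exists_bestPayoff_eq hσ
  obtain ⟨c, hc⟩ := h.exists_bestPayoff_le hn hsim hspos (g σ)
  have h1 := h.payoff_lt_bestPayoff (isPosDef_diagState (g σ) hsim hspos) hσ hne a
  have h2 : payoff r (g σ) a σ σ'.op = payoff r (g σ) a σ σ.op := by
    simp only [payoff_op, hσ', outcomeProb_diagState_self]
    rfl
  have h3 : ∑ i, s i * r (c i) (s i) = payoff r (g σ) c σ σ.op := rfl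
  rw [h2, ← ha] at h1
  rw [h3] at hc
  exact absurd (h1.trans_le (hc.trans (h.payoff_self_le_bestPayoff hσ c))) (lt_irrefl _)

theorem HonestOnPosDef.isProperScoring [CompleteSpace H] [FiniteDimensional ℂ H]
    (h : HonestOnPosDef g r) (hn : 0 < n) (e : OrthonormalBasis (Fin n) ℂ H) :
    IsProperScoring r := by
  intro p s hp hs hp1 hs1 hne a b
  have hpm : p ∈ stdSimplex ℝ (Fin n) := ⟨fun i => (hp i).le, hp1⟩
  have hsm : s ∈ stdSimplex ℝ (Fin n) := ⟨fun i => (hs i).le, hs1⟩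
  set σ := diagState e s hsm with hσ
  have hσpos : σ.IsPosDef := isPosDef_diagState e hsm hs
  obtain ⟨c, hc⟩ := (h.diagonalizes hn hσpos).exists_perm (diagonalizes_diagState e s hsm)
  replace hc : ∀ i, outcomeProb (g σ) σ (c i) = s i :=
    fun i => (hc i).trans (outcomeProb_diagState_self _ _ _ _)
  -- The state with spectrum `p` whose eigenvector for `p i` is the one of `σ` for `s i`.
  set ρ := diagState ((g σ).reindex c.symm) p hpm with hρ
  have hρσ : ∀ i, outcomeProb (g σ) ρ (c i) = p i := by
    intro i
    have := outcomeProb_diagState_self ((g σ).reindex c.symm) p hpm i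
    rwa [outcomeProb_reindex, Equiv.symm_symm, ← hρ] at this
  have hρpos : ρ.IsPosDef := isPosDef_diagState _ hpm hp
  have hρne : ρ ≠ σ := by
    intro heq
    apply hne
    funext i
    rw [← hρσ i, ← hc i, heq]
  obtain ⟨d, hd⟩ := (h.diagonalizes hn hρpos).exists_perm (diagonalizes_diagState _ p hpm)
  replace hd : ∀ i, outcomeProb (g ρ) ρ (d i) = p i :=
    fun i => (hd i).trans (outcomeProb_diagState_self _ _ _ _)
  have key := h ρ σ hρpos hσpos hρne (d.symm.trans a) (c.symm.trans b)
  have h1 : payoff r (g σ) (c.symm.trans b) σ ρ.op = ∑ i, p i * r (b i) (s i) := by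
    rw [payoff_op, ← Equiv.sum_comp c]
    simp [hρσ, hc]
  have h2 : payoff r (g ρ) (d.symm.trans a) ρ ρ.op = ∑ i, p i * r (a i) (p i) := by
    rw [payoff_op, ← Equiv.sum_comp d]
    simp [hd]
  rwa [h1, h2] at key

end PositiveDefinite

/-! ### Extended real rewards -/

section Rewards

open Filter Topology Set

variable {H : Type*} [NormedAddCommGroup H] [InnerProductSpace ℂ H] {n : ℕ}

theorem EReal.coe_sum_eq {ι : Type*} (s : Finset ι) (f : ι → ℝ) :
    ((∑ i ∈ s, f i : ℝ) : EReal) = ∑ i ∈ s, (f i : EReal) := by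
  classical
  induction s using Finset.induction_on with
  | empty => simp
  | insert a s ha ih => rw [Finset.sum_insert ha, Finset.sum_insert ha, EReal.coe_add, ih]

theorem EReal.sum_eq_bot {ι : Type*} {s : Finset ι} {f : ι → EReal} {i : ι} (hi : i ∈ s)
    (hf : f i = ⊥) : ∑ j ∈ s, f j = ⊥ := by
  classical
  rw [← Finset.add_sum_erase s f hi, hf, EReal.bot_add]

/-- The expected reward when the measured basis is numbered by `b`. -/
noncomputable def numberedReward (R : Fin n → ℝ → EReal) (e : OrthonormalBasis (Fin n) ℂ H)
    (b : Equiv.Perm (Fin n)) (ρ σ : DensityOperator H) : EReal :=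
  ∑ i, (outcomeProb e ρ i : EReal) * R (b i) (outcomeProb e σ i)

theorem expectedReward_relabel (g : DensityOperator H → OrthonormalBasis (Fin n) ℂ H)
    (R : Fin n → ℝ → EReal) (π : DensityOperator H → Equiv.Perm (Fin n))
    (ρ σ : DensityOperator H) :
    expectedReward (relabel g π) R ρ σ = numberedReward R (g σ) (π σ) ρ σ := by
  rw [expectedReward, numberedReward, ← Equiv.sum_comp (π σ)]
  simp [relabel, outcomeProb_reindex]

/-- Since the numbering may depend on the report, the honest and the dishonest report may be
numbered independently of each other. -/
theorem numberedReward_lt {g : DensityOperator H → OrthonormalBasis (Fin n) ℂ H}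
    {R : Fin n → ℝ → EReal}
    (hhonest : ∀ π : DensityOperator H → Equiv.Perm (Fin n), EnsuresHonesty (relabel g π) R)
    {ρ σ : DensityOperator H} (hne : ρ ≠ σ) (a b : Equiv.Perm (Fin n)) :
    numberedReward R (g σ) b ρ σ < numberedReward R (g ρ) a ρ ρ := by
  classical
  have h := hhonest (Function.update (fun _ => a) σ b) ρ σ
  rw [expectedReward_relabel, expectedReward_relabel, Function.update_self,
    Function.update_of_ne hne] at h
  exact lt_of_le_of_ne h.1 fun heq => hne (h.2.1 heq)

theorem vertex_mem_stdSimplex (i : Fin n) :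
    (fun k => if k = i then (1 : ℝ) else 0) ∈ stdSimplex ℝ (Fin n) :=
  ⟨fun k => by dsimp only; split_ifs <;> norm_num, by simp⟩

theorem exists_state_ne (hn : 2 ≤ n) (e : OrthonormalBasis (Fin n) ℂ H) (ρ : DensityOperator H) :
    ∃ σ, ρ ≠ σ := by
  by_contra! h
  have h1 := (h (diagState e _ (vertex_mem_stdSimplex ⟨0, by omega⟩))).symm.trans
    (h (diagState e _ (vertex_mem_stdSimplex ⟨1, by omega⟩)))
  have h2 := congrArg (fun σ => outcomeProb e σ ⟨0, by omega⟩) h1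
  simp [outcomeProb_diagState_self] at h2

variable {g : DensityOperator H → OrthonormalBasis (Fin n) ℂ H} {R : Fin n → ℝ → EReal}

/-- An honest report of a full rank state can meet no infinite penalty. -/
theorem reward_ne_bot (hn : 2 ≤ n)
    (hhonest : ∀ π : DensityOperator H → Equiv.Perm (Fin n), EnsuresHonesty (relabel g π) R)
    {ρ : DensityOperator H} (hρ : ρ.IsPosDef) (i j : Fin n) :
    R i (outcomeProb (g ρ) ρ j) ≠ ⊥ := by
  intro hbot
  obtain ⟨σ, hσ⟩ := exists_state_ne hn (g ρ) ρ
  have h := numberedReward_lt hhonest hσ (Equiv.swap j i) 1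
  have h2 : numberedReward R (g ρ) (Equiv.swap j i) ρ ρ = ⊥ := by
    refine EReal.sum_eq_bot (Finset.mem_univ j) ?_
    rw [Equiv.swap_apply_left, hbot]
    exact EReal.coe_mul_bot_of_pos (hρ.outcomeProb_pos _ _)
  rw [h2] at h
  exact not_lt_bot h

theorem coe_toReal_reward (hn : 2 ≤ n) (hR : ∀ i, ∀ x ∈ Icc (0 : ℝ) 1, R i x ≠ ⊤)
    (hhonest : ∀ π : DensityOperator H → Equiv.Perm (Fin n), EnsuresHonesty (relabel g π) R)
    {ρ : DensityOperator H} (hρ : ρ.IsPosDef) (i j : Fin n) :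
    (((R i (outcomeProb (g ρ) ρ j)).toReal : ℝ) : EReal) = R i (outcomeProb (g ρ) ρ j) :=
  EReal.coe_toReal (hR i _ ⟨outcomeProb_nonneg _ _ _, outcomeProb_le_one _ _ _⟩)
    (reward_ne_bot hn hhonest hρ i j)

theorem honestOnPosDef_toReal (hn : 2 ≤ n) (hR : ∀ i, ∀ x ∈ Icc (0 : ℝ) 1, R i x ≠ ⊤)
    (hhonest : ∀ π : DensityOperator H → Equiv.Perm (Fin n), EnsuresHonesty (relabel g π) R) :
    HonestOnPosDef g fun i x => (R i x).toReal := by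
  have key : ∀ ρ σ : DensityOperator H, σ.IsPosDef → ∀ b, numberedReward R (g σ) b ρ σ
      = (payoff (fun i x => (R i x).toReal) (g σ) b σ ρ.op : ℝ) := by
    intro ρ σ hσ b
    rw [payoff_op, EReal.coe_sum_eq, numberedReward]
    refine Finset.sum_congr rfl fun i _ => ?_
    rw [EReal.coe_mul, coe_toReal_reward hn hR hhonest hσ]
  intro ρ σ hρ hσ hne a b
  have h := numberedReward_lt hhonest hne a b
  rw [key _ _ hσ, key _ _ hρ] at h
  exact_mod_cast h

theorem reward_ne_bot_of_mem_Ioo [CompleteSpace H] [FiniteDimensional ℂ H]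
    (e : OrthonormalBasis (Fin n) ℂ H) (hn : 2 ≤ n) (hR : ∀ i, ∀ x ∈ Icc (0 : ℝ) 1, R i x ≠ ⊤)
    (hhonest : ∀ π : DensityOperator H → Equiv.Perm (Fin n), EnsuresHonesty (relabel g π) R)
    (i : Fin n) {x : ℝ} (hx : x ∈ Ioo (0 : ℝ) 1) : R i x ≠ ⊥ := by
  have hn1 : (0 : ℝ) < (n : ℝ) - 1 := by
    have : (2 : ℝ) ≤ n := by exact_mod_cast hn
    linarith
  let p : Fin n → ℝ := fun k => if k = i then x else (1 - x) / (n - 1)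
  have hpos : ∀ k, 0 < p k := by
    intro k
    simp only [p]
    split_ifs
    · exact hx.1
    · exact div_pos (by linarith [hx.2]) hn1
  have hsum : ∑ k, p k = 1 := by
    rw [← Finset.add_sum_erase _ _ (Finset.mem_univ i)]
    have h1 : ∀ k ∈ Finset.univ.erase i, p k = (1 - x) / (n - 1) := by
      intro k hk
      simp [p, Finset.ne_of_mem_erase hk]
    rw [Finset.sum_congr rfl h1, Finset.sum_const, Finset.card_erase_of_mem (Finset.mem_univ i),
      Finset.card_univ, Fintype.card_fin, nsmul_eq_mul, Nat.cast_sub (by omega)]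
    simp only [p, if_true, Nat.cast_one]
    field_simp
    ring
  have hp : p ∈ stdSimplex ℝ (Fin n) := ⟨fun k => (hpos k).le, hsum⟩
  have hσ := isPosDef_diagState e hp hpos
  obtain ⟨c, hc⟩ := ((honestOnPosDef_toReal hn hR hhonest).diagonalizes (by omega) hσ).exists_perm
    (diagonalizes_diagState e p hp)
  have h1 : outcomeProb (g (diagState e p hp)) (diagState e p hp) (c i) = x := by
    rw [hc, outcomeProb_diagState_self]
    simp [p]
  rw [← h1]
  exact reward_ne_bot hn hhonest hσ _ _

/-- The payments between `0` and `1` are logarithmic. -/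
theorem exists_reward_eq_log [CompleteSpace H] [FiniteDimensional ℂ H]
    (e : OrthonormalBasis (Fin n) ℂ H) (hn : 3 ≤ n) (hR : ∀ i, ∀ x ∈ Icc (0 : ℝ) 1, R i x ≠ ⊤)
    (hhonest : ∀ π : DensityOperator H → Equiv.Perm (Fin n), EnsuresHonesty (relabel g π) R) :
    ∃ C D : ℝ, 0 < D ∧
      ∀ i, ∀ x ∈ Ioo (0 : ℝ) 1, R i x = ((C + D * Real.log x : ℝ) : EReal) := by
  obtain ⟨C, D, hD, h⟩ := ((honestOnPosDef_toReal (by omega) hR hhonest).isProperScoring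
    (by omega) e).eq_log hn
  refine ⟨C, D, hD, fun i x hx => ?_⟩
  rw [← h i x hx]
  exact (EReal.coe_toReal (hR i x ⟨hx.1.le, hx.2.le⟩)
    (reward_ne_bot_of_mem_Ioo e (by omega) hR hhonest i hx)).symm

/-! ### States that are not of full rank -/

theorem sum_mul_reward_eq {C D : ℝ}
    (hlog : ∀ i, ∀ x ∈ Ioo (0 : ℝ) 1, R i x = ((C + D * Real.log x : ℝ) : EReal))
    {p s : Fin n → ℝ} (hp : ∑ i, p i = 1) (h : ∀ i, p i ≠ 0 → s i ∈ Ioo (0 : ℝ) 1)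
    (b : Equiv.Perm (Fin n)) :
    ∑ i, (p i : EReal) * R (b i) (s i) = ((C + D * ∑ i, p i * Real.log (s i) : ℝ) : EReal) := by
  have : C + D * ∑ i, p i * Real.log (s i) = ∑ i, p i * (C + D * Real.log (s i)) := by
    simp only [mul_add, Finset.sum_add_distrib, ← Finset.sum_mul, hp, Finset.mul_sum]
    rw [one_mul]
    congr 1
    exact Finset.sum_congr rfl fun i _ => by ring
  rw [this, EReal.coe_sum_eq]
  refine Finset.sum_congr rfl fun i _ => ?_
  by_cases hi : p i = 0
  · simp [hi]
  · rw [hlog _ _ (h i hi), EReal.coe_mul]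

theorem eq_zero_of_sum_eq_one {p : Fin n → ℝ} (hp : p ∈ stdSimplex ℝ (Fin n)) {i j : Fin n}
    (hi : p i = 1) (hij : j ≠ i) : p j = 0 := by
  have h := hp.2
  rw [← Finset.add_sum_erase _ _ (Finset.mem_univ i), hi] at h
  have h0 : ∑ k ∈ Finset.univ.erase i, p k = 0 := by linarith
  exact (Finset.sum_eq_zero_iff_of_nonneg fun k _ => hp.1 k).1 h0 j (by simp [hij])

theorem op_basis_eq_zero [CompleteSpace H] (b : OrthonormalBasis (Fin n) ℂ H)
    (σ : DensityOperator H) {i : Fin n} (hi : outcomeProb b σ i = 0) : σ.op (b i) = 0 :=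
  op_eq_zero_of_inner_re_eq_zero σ _ hi

/-- A state for which some outcome is certain is the projection onto that basis vector. -/
theorem eq_diagState_of_outcomeProb_eq_one [CompleteSpace H] (b : OrthonormalBasis (Fin n) ℂ H)
    {σ : DensityOperator H} {i : Fin n} (hi : outcomeProb b σ i = 1) :
    σ = diagState b _ (vertex_mem_stdSimplex i) := by
  have hz : ∀ j, j ≠ i → σ.op (b j) = 0 := fun j hj => op_basis_eq_zero b σ
    (eq_zero_of_sum_eq_one (outcomeProb_mem_stdSimplex b σ) hi hj)
  have hdiag : Diagonalizes b σ := by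
    intro j
    by_cases hj : j = i
    · subst hj
      refine ⟨inner ℂ (b j) (σ.op (b j)), ?_⟩
      refine (b.sum_repr' (σ.op (b j))).symm.trans ?_
      rw [Finset.sum_eq_single j]
      · intro k _ hk
        rw [← σ.pos.inner_left_eq_inner_right, hz k hk, inner_zero_left, zero_smul]
      · simp
    · exact ⟨0, by rw [hz j hj, zero_smul]⟩
  refine DensityOperator.ext_basis b fun j => ?_
  rw [diagState_op_basis, hdiag.op_apply]
  by_cases hj : j = i
  · subst hj; simp [hi]
  · simp [hj, eq_zero_of_sum_eq_one (outcomeProb_mem_stdSimplex b σ) hi hj]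

theorem isPure_of_outcomeProb_eq_one [CompleteSpace H] (b : OrthonormalBasis (Fin n) ℂ H)
    {σ : DensityOperator H} {i : Fin n} (hi : outcomeProb b σ i = 1) : σ.IsPure := by
  have h := eq_diagState_of_outcomeProb_eq_one b hi
  apply ContinuousLinearMap.coe_injective
  refine b.toBasis.ext fun j => ?_
  have hj : σ.op (b j) = ((if j = i then 1 else 0 : ℝ) : ℂ) • b j := by
    conv_lhs => rw [h]
    exact diagState_op_basis _ _ _ _
  by_cases hji : j = i
  · simp [hji] at hj
    simp [hji, hj]
  · simp [hji] at hj
    simp [hj]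

theorem outcomeProb_lt_one_of_not_diagonalizes [CompleteSpace H]
    (b : OrthonormalBasis (Fin n) ℂ H) {σ : DensityOperator H} (h : ¬ Diagonalizes b σ)
    (i : Fin n) : outcomeProb b σ i < 1 :=
  lt_of_le_of_ne (outcomeProb_le_one b σ i) fun hi => h (by
    rw [eq_diagState_of_outcomeProb_eq_one b hi]
    exact diagonalizes_diagState b _ _)

/-- Measuring in another basis than the eigenbasis increases the entropy (Jensen's inequality). -/
theorem sum_mul_log_diagState_le (b e : OrthonormalBasis (Fin n) ℂ H) {s : Fin n → ℝ}
    (hs : s ∈ stdSimplex ℝ (Fin n)) :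
    ∑ j, outcomeProb e (diagState b s hs) j * Real.log (outcomeProb e (diagState b s hs) j)
      ≤ ∑ i, s i * Real.log (s i) := by
  have hcol : ∀ j, ∑ i, ‖inner ℂ (b i) (e j)‖ ^ 2 = 1 := fun j => by
    rw [b.sum_sq_norm_inner_right]; simp
  have hrow : ∀ i, ∑ j, ‖inner ℂ (b i) (e j)‖ ^ 2 = 1 := fun i => by
    rw [e.sum_sq_norm_inner_left]; simp
  calc _ ≤ ∑ j, ∑ i, ‖inner ℂ (b i) (e j)‖ ^ 2 * (s i * Real.log (s i)) := by
        refine Finset.sum_le_sum fun j _ => ?_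
        have h := Real.convexOn_mul_log.map_sum_le (t := Finset.univ)
          (w := fun i => ‖inner ℂ (b i) (e j)‖ ^ 2) (p := s) (fun i _ => sq_nonneg _) (hcol j)
          (fun i _ => hs.1 i)
        simp only [smul_eq_mul] at h
        have he : outcomeProb e (diagState b s hs) j = ∑ i, ‖inner ℂ (b i) (e j)‖ ^ 2 * s i := by
          rw [outcomeProb_diagState]
          exact Finset.sum_congr rfl fun i _ => mul_comm _ _
        rw [he]
        exact h
    _ = ∑ i, s i * Real.log (s i) := by
        rw [Finset.sum_comm]
        refine Finset.sum_congr rfl fun i _ => ?_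
        rw [← Finset.sum_mul, hrow, one_mul]

theorem outcomeProb_diagState_lt_one (b e : OrthonormalBasis (Fin n) ℂ H) {s : Fin n → ℝ}
    (hs : s ∈ stdSimplex ℝ (Fin n)) (hlt : ∀ i, s i < 1) (j : Fin n) :
    outcomeProb e (diagState b s hs) j < 1 := by
  have hcol : ∑ i, ‖inner ℂ (b i) (e j)‖ ^ 2 = 1 := by
    rw [b.sum_sq_norm_inner_right]; simp
  obtain ⟨i, hi⟩ := exists_inner_ne_zero b (e.orthonormal.ne_zero j)
  rw [outcomeProb_diagState, ← hcol]
  refine Finset.sum_lt_sum (fun k _ => ?_) ⟨i, Finset.mem_univ i, ?_⟩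
  · exact mul_le_of_le_one_left (sq_nonneg _) (hlt k).le
  · exact mul_lt_of_lt_one_left (pow_pos (norm_pos_iff.2 hi) 2) (hlt i)

/-- Every state is measured in an eigenbasis. -/
theorem diagonalizes_of_reward_eq_log [CompleteSpace H] {C D : ℝ} (hD : 0 < D)
    (hlog : ∀ i, ∀ x ∈ Ioo (0 : ℝ) 1, R i x = ((C + D * Real.log x : ℝ) : EReal))
    (hhonest : ∀ π : DensityOperator H → Equiv.Perm (Fin n), EnsuresHonesty (relabel g π) R)
    (σ : DensityOperator H) : Diagonalizes (g σ) σ := by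
  by_contra hnot
  set s := outcomeProb (g σ) σ with hs
  have hsm : s ∈ stdSimplex ℝ (Fin n) := outcomeProb_mem_stdSimplex _ _
  have hlt : ∀ i, s i < 1 := outcomeProb_lt_one_of_not_diagonalizes _ hnot
  set σ' := diagState (g σ) s hsm with hσ'
  have hne : σ' ≠ σ := by
    intro heq
    have := diagonalizes_diagState (g σ) s hsm
    rw [← hσ', heq] at this
    exact hnot this
  have h := numberedReward_lt hhonest hne 1 1
  have h1 : ∀ i, outcomeProb (g σ) σ' i = s i := outcomeProb_diagState_self _ _ _
  have h2 : ∀ i, outcomeProb (g σ') σ' i < 1 := outcomeProb_diagState_lt_one (g σ) (g σ') hsm hlt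
  rw [numberedReward, numberedReward, sum_mul_reward_eq hlog (sum_outcomeProb _ _),
    sum_mul_reward_eq hlog (sum_outcomeProb _ _), EReal.coe_lt_coe_iff] at h
  · simp only [h1] at h
    have h3 := sum_mul_log_diagState_le (g σ) (g σ') hsm
    rw [← hσ'] at h3
    have h4 := mul_le_mul_of_nonneg_left h3 hD.le
    exact absurd h (not_lt.2 (by simpa [hs] using h4))
  · exact fun i hi => ⟨lt_of_le_of_ne (outcomeProb_nonneg _ _ _) hi.symm, h2 i⟩
  · intro i hi
    rw [h1] at hi
    exact ⟨lt_of_le_of_ne (hsm.1 i) hi.symm, hlt i⟩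

/-- Once all measured bases are eigenbases, the payments are honest for all classical
distributions, not only for those with positive entries. -/
theorem sum_mul_reward_lt (hdiag : ∀ σ, Diagonalizes (g σ) σ)
    (hhonest : ∀ π : DensityOperator H → Equiv.Perm (Fin n), EnsuresHonesty (relabel g π) R)
    (e : OrthonormalBasis (Fin n) ℂ H) {p s : Fin n → ℝ} (hp : p ∈ stdSimplex ℝ (Fin n))
    (hs : s ∈ stdSimplex ℝ (Fin n)) (hne : p ≠ s) (a b : Equiv.Perm (Fin n)) :
    ∑ i, (p i : EReal) * R (b i) (s i) < ∑ i, (p i : EReal) * R (a i) (p i) := by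
  set σ := diagState e s hs with hσ
  obtain ⟨c, hc⟩ := (hdiag σ).exists_perm (diagonalizes_diagState e s hs)
  replace hc : ∀ i, outcomeProb (g σ) σ (c i) = s i :=
    fun i => (hc i).trans (outcomeProb_diagState_self _ _ _ _)
  set ρ := diagState ((g σ).reindex c.symm) p hp with hρ
  have hρσ : ∀ i, outcomeProb (g σ) ρ (c i) = p i := by
    intro i
    have := outcomeProb_diagState_self ((g σ).reindex c.symm) p hp i
    rwa [outcomeProb_reindex, Equiv.symm_symm, ← hρ] at this
  have hρne : ρ ≠ σ := by
    intro heq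
    apply hne
    funext i
    rw [← hρσ i, ← hc i, heq]
  obtain ⟨d, hd⟩ := (hdiag ρ).exists_perm (diagonalizes_diagState _ p hp)
  replace hd : ∀ i, outcomeProb (g ρ) ρ (d i) = p i :=
    fun i => (hd i).trans (outcomeProb_diagState_self _ _ _ _)
  have key := numberedReward_lt hhonest hρne (d.symm.trans a) (c.symm.trans b)
  have h1 : numberedReward R (g σ) (c.symm.trans b) ρ σ = ∑ i, (p i : EReal) * R (b i) (s i) := by
    rw [numberedReward, ← Equiv.sum_comp c]
    simp [hρσ, hc]
  have h2 : numberedReward R (g ρ) (d.symm.trans a) ρ ρ = ∑ i, (p i : EReal) * R (a i) (p i) := by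
    rw [numberedReward, ← Equiv.sum_comp d]
    simp [hd]
  rwa [h1, h2] at key

end Rewards

/-! ### The payments for impossible and for certain outcomes -/

section Endpoints

open Filter Topology Set

variable {H : Type*} [NormedAddCommGroup H] [InnerProductSpace ℂ H] {n : ℕ}
variable {g : DensityOperator H → OrthonormalBasis (Fin n) ℂ H} {R : Fin n → ℝ → EReal}

/-- A distribution supported on the outcomes `0`, `1`, `2`. -/
def threePoint (n : ℕ) (u v w : ℝ) : Fin n → ℝ := fun k =>
  if k.val = 0 then u else if k.val = 1 then v else if k.val = 2 then w else 0

theorem sum_threePoint (hn : 3 ≤ n) (u v w : ℝ) (F : Fin n → ℝ → ℝ) (hF : ∀ k, F k 0 = 0) :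
    ∑ k, F k (threePoint n u v w k)
      = F ⟨0, by omega⟩ u + F ⟨1, by omega⟩ v + F ⟨2, by omega⟩ w := by
  obtain ⟨m, rfl⟩ : ∃ m, n = m + 3 := ⟨n - 3, by omega⟩
  rw [Fin.sum_univ_succ, Fin.sum_univ_succ, Fin.sum_univ_succ, Finset.sum_eq_zero, add_zero,
    ← add_assoc]
  · rfl
  · intro k _
    have : threePoint (m + 3) u v w k.succ.succ.succ = 0 := by simp [threePoint]
    rw [this, hF]

theorem threePoint_mem_stdSimplex (hn : 3 ≤ n) {u v w : ℝ} (hu : 0 ≤ u) (hv : 0 ≤ v) (hw : 0 ≤ w)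
    (h : u + v + w = 1) : threePoint n u v w ∈ stdSimplex ℝ (Fin n) := by
  refine ⟨fun k => ?_, ?_⟩
  · simp only [threePoint]
    split_ifs <;> first | assumption | exact le_rfl
  · rw [← h]
    exact sum_threePoint hn u v w (fun _ x => x) fun _ => rfl

/-- The payment for an outcome of reported probability `0` is `-∞`: a finite payment would reward
the report that an outcome of small probability `ε` is impossible, because the honest report
costs about `ε ln ε` there. -/
theorem reward_zero_eq_bot (hn : 3 ≤ n) (hR : ∀ i, R i 0 ≠ ⊤)
    (hdiag : ∀ σ, Diagonalizes (g σ) σ)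
    (hhonest : ∀ π : DensityOperator H → Equiv.Perm (Fin n), EnsuresHonesty (relabel g π) R)
    (e : OrthonormalBasis (Fin n) ℂ H) {C D : ℝ} (hD : 0 < D)
    (hlog : ∀ i, ∀ x ∈ Ioo (0 : ℝ) 1, R i x = ((C + D * Real.log x : ℝ) : EReal))
    (i : Fin n) : R i 0 = ⊥ := by
  by_contra hbot
  set c := (R i 0).toReal with hc
  have hRc : R i 0 = (c : EReal) := (EReal.coe_toReal (hR i) hbot).symm
  have key : ∀ ε : ℝ, 0 < ε → ε < 1 → c - C < D * Real.log ε := by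
    intro ε hε hε1
    let i₂ : Fin n := ⟨2, by omega⟩
    let b : Equiv.Perm (Fin n) := Equiv.swap i₂ i
    have hp := threePoint_mem_stdSimplex hn (u := (1 - ε) / 2) (v := (1 - ε) / 2) (w := ε)
      (by linarith) (by linarith) hε.le (by ring)
    have hs := threePoint_mem_stdSimplex hn (u := 1 / 2) (v := 1 / 2) (w := 0)
      (by norm_num) (by norm_num) le_rfl (by norm_num)
    have hne : threePoint n ((1 - ε) / 2) ((1 - ε) / 2) ε ≠ threePoint n (1 / 2) (1 / 2) 0 := by
      intro h
      have := congrFun h i₂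
      simp [threePoint, i₂] at this
      exact hε.ne' this
    have h := sum_mul_reward_lt hdiag hhonest e hp hs hne 1 b
    have hL : ∑ k, (threePoint n ((1 - ε) / 2) ((1 - ε) / 2) ε k : EReal)
          * R (b k) (threePoint n (1 / 2) (1 / 2) 0 k)
        = (((1 - ε) * (C + D * Real.log (1 / 2)) + ε * c : ℝ) : EReal) := by
      let F : Fin n → ℝ → ℝ := fun k x => x * (if k = i₂ then c else C + D * Real.log (1 / 2))
      have h1 : (1 - ε) * (C + D * Real.log (1 / 2)) + ε * c
          = ∑ k, F k (threePoint n ((1 - ε) / 2) ((1 - ε) / 2) ε k) := by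
        rw [sum_threePoint hn _ _ _ F (by simp [F])]
        simp [F, i₂]
        ring
      rw [h1, EReal.coe_sum_eq]
      refine Finset.sum_congr rfl fun k _ => ?_
      simp only [F]
      by_cases hk2 : k = i₂
      · have : threePoint n (1 / 2) (1 / 2) 0 k = 0 := by simp [hk2, threePoint, i₂]
        rw [this, EReal.coe_mul, if_pos hk2, ← hRc, hk2, Equiv.swap_apply_left]
      · have hk2' : k.val ≠ 2 := fun h => hk2 (Fin.ext h)
        by_cases hk : k.val = 0 ∨ k.val = 1
        · have : threePoint n (1 / 2) (1 / 2) 0 k = 1 / 2 := by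
            rcases hk with hk | hk <;> simp [hk, threePoint]
          rw [this, EReal.coe_mul, if_neg hk2, hlog _ _ ⟨by norm_num, by norm_num⟩]
        · push Not at hk
          have : threePoint n ((1 - ε) / 2) ((1 - ε) / 2) ε k = 0 := by
            simp [threePoint, hk.1, hk.2, hk2']
          rw [this]
          simp
    rw [hL, sum_mul_reward_eq hlog hp.2,
      sum_threePoint hn _ _ _ (fun _ x => x * Real.log x) (by simp),
      EReal.coe_lt_coe_iff] at h
    swap
    · intro k hk
      simp only [threePoint] at hk ⊢
      split_ifs with h0 h1 h2
      · constructor <;> linarith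
      · constructor <;> linarith
      · exact ⟨hε, hε1⟩
      · simp [h0, h1, h2] at hk
    have hlog2 : Real.log ((1 - ε) / 2) ≤ Real.log (1 / 2) :=
      Real.log_le_log (by linarith) (by linarith)
    have h3 : D * ((1 - ε) * Real.log ((1 - ε) / 2)) ≤ D * ((1 - ε) * Real.log (1 / 2)) :=
      mul_le_mul_of_nonneg_left (mul_le_mul_of_nonneg_left hlog2 (by linarith)) hD.le
    have h4 : ε * (c - C) < ε * (D * Real.log ε) := by linarith
    exact lt_of_mul_lt_mul_left h4 hε.le
  have h := key (Real.exp (-(|c - C| / D) - 1)) (Real.exp_pos _)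
    (Real.exp_lt_one_iff.2 (by have : 0 ≤ |c - C| / D := by positivity
                               linarith))
  rw [Real.log_exp, mul_sub, mul_neg, mul_div_cancel₀ _ hD.ne'] at h
  linarith [neg_abs_le (c - C)]

theorem tendsto_log_at_one (C D : ℝ) :
    Tendsto (fun x : ℝ => ((C + D * Real.log x : ℝ) : EReal)) (𝓝[<] 1) (𝓝 (C : EReal)) := by
  have h : ContinuousAt (fun x : ℝ => C + D * Real.log x) 1 := by
    have := Real.continuousAt_log (one_ne_zero (α := ℝ))
    fun_prop
  have h2 : Tendsto (fun x : ℝ => C + D * Real.log x) (𝓝[<] 1) (𝓝 C) := by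
    simpa using h.tendsto.mono_left nhdsWithin_le_nhds
  exact (continuous_coe_real_ereal.tendsto C).comp h2

/-- The payment for a certain outcome is at least the limit of the payments for nearly certain
outcomes: otherwise a pure state would better be reported as slightly mixed. -/
theorem le_reward_one (hn : 3 ≤ n)
    (hdiag : ∀ σ, Diagonalizes (g σ) σ)
    (hhonest : ∀ π : DensityOperator H → Equiv.Perm (Fin n), EnsuresHonesty (relabel g π) R)
    (e : OrthonormalBasis (Fin n) ℂ H) {C D : ℝ}
    (hlog : ∀ i, ∀ x ∈ Ioo (0 : ℝ) 1, R i x = ((C + D * Real.log x : ℝ) : EReal))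
    (i : Fin n) : (C : EReal) ≤ R i 1 := by
  refine le_of_tendsto (tendsto_log_at_one C D) ?_
  filter_upwards [Ioo_mem_nhdsLT (show (0 : ℝ) < 1 by norm_num)] with x hx
  let i₀ : Fin n := ⟨0, by omega⟩
  let b : Equiv.Perm (Fin n) := Equiv.swap i₀ i
  have hs := threePoint_mem_stdSimplex hn (u := x) (v := 1 - x) (w := 0) hx.1.le
    (by linarith [hx.2]) le_rfl (by ring)
  have hp := vertex_mem_stdSimplex i₀
  have hne : (fun k => if k = i₀ then (1 : ℝ) else 0) ≠ threePoint n x (1 - x) 0 := by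
    intro h
    have := congrFun h i₀
    simp [threePoint, i₀] at this
    exact hx.2.ne' this
  have h := sum_mul_reward_lt hdiag hhonest e hp hs hne b b
  rw [Finset.sum_eq_single i₀ (fun k _ hk => by simp [hk]) (by simp),
    Finset.sum_eq_single i₀ (fun k _ hk => by simp [hk]) (by simp)] at h
  have h0 : threePoint n x (1 - x) 0 i₀ = x := by simp [threePoint, i₀]
  simp only [if_true, EReal.coe_one, one_mul, h0, b, Equiv.swap_apply_left] at h
  rw [hlog i x hx] at h
  exact h.le

theorem reward_one_eq {C D : ℝ}
    (hlog : ∀ i, ∀ x ∈ Ioo (0 : ℝ) 1, R i x = ((C + D * Real.log x : ℝ) : EReal))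
    (i : Fin n) (hcont : ContinuousWithinAt (R i) (Iio 1) 1) : R i 1 = (C : EReal) := by
  refine tendsto_nhds_unique hcont ((tendsto_log_at_one C D).congr' ?_)
  filter_upwards [Ioo_mem_nhdsLT (show (0 : ℝ) < 1 by norm_num)] with x hx
  exact (hlog i x hx).symm

end Endpoints

/-! ### The expected loss -/

section RelativeEntropy

open Filter Topology Set Polynomial

variable {H : Type*} [NormedAddCommGroup H] [InnerProductSpace ℂ H] {n : ℕ}

theorem aeval_apply_of_apply_eq_smul (A : H →L[ℂ] H) {v : H} {c : ℝ} (h : A v = (c : ℂ) • v)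
    (q : ℝ[X]) : (aeval A q) v = ((q.eval c : ℝ) : ℂ) • v := by
  induction q using Polynomial.induction_on' with
  | add p q hp hq => simp only [map_add, add_apply, hp, hq, eval_add, Complex.ofReal_add, add_smul]
  | monomial k a =>
    rw [aeval_monomial, eval_monomial]
    have hk : ∀ k : ℕ, (A ^ k) v = ((c ^ k : ℝ) : ℂ) • v := by
      intro k
      induction k with
      | zero => simp
      | succ k ih =>
        rw [pow_succ, mul_apply_eq_comp, h, map_smul, ih, smul_smul, pow_succ,
          Complex.ofReal_mul, mul_comm]
    rw [mul_apply_eq_comp, hk, Algebra.algebraMap_eq_smul_one, smul_apply,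
      one_apply_eq_self, ← Complex.coe_smul, smul_smul, Complex.ofReal_mul]

/-- The functional calculus of a state with eigenbasis `b` acts on `b` through the eigenvalues:
on the finite spectrum the logarithm agrees with an interpolating polynomial. -/
theorem log_op_basis [CompleteSpace H] {b : OrthonormalBasis (Fin n) ℂ H} {σ : DensityOperator H}
    (h : Diagonalizes b σ) (i : Fin n) :
    (CFC.log σ.op) (b i) = ((Real.log (outcomeProb b σ i) : ℝ) : ℂ) • b i := by
  classical
  set s := outcomeProb b σ
  set S : Finset ℝ := Finset.univ.image s with hS
  have hann : aeval σ.op (∏ x ∈ S, (X - C x)) = 0 := by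
    apply ContinuousLinearMap.coe_injective
    refine b.toBasis.ext fun j => ?_
    have h0 : (∏ x ∈ S, (X - C x)).eval (s j) = 0 := by
      rw [eval_prod]
      exact Finset.prod_eq_zero (Finset.mem_image_of_mem s (Finset.mem_univ j)) (by simp)
    have := aeval_apply_of_apply_eq_smul σ.op (h.op_apply j) (∏ x ∈ S, (X - C x))
    rw [h0] at this
    simpa using this
  have hspec : spectrum ℝ σ.op ⊆ S := by
    intro x hx
    have : Nontrivial H := ⟨b i, 0, b.orthonormal.ne_zero i⟩
    have h1 := spectrum.subset_polynomial_aeval σ.op (∏ x ∈ S, (X - C x)) ⟨x, hx, rfl⟩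
    rw [hann, spectrum.zero_eq, Set.mem_singleton_iff] at h1
    simp only [eval_prod, Finset.prod_eq_zero_iff, eval_sub, eval_X, eval_C] at h1
    obtain ⟨y, hy, hxy⟩ := h1
    rwa [sub_eq_zero.1 hxy]
  set q : ℝ[X] := Lagrange.interpolate S id Real.log with hq
  have hqS : ∀ x ∈ S, q.eval x = Real.log x := fun x hx =>
    Lagrange.eval_interpolate_at_node (v := id) Real.log (Set.injOn_id _) hx
  have hlog : CFC.log σ.op = aeval σ.op q := by
    rw [CFC.log, ← cfc_polynomial q σ.op σ.pos.isSelfAdjoint]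
    exact cfc_congr fun x hx => (hqS x (hspec hx)).symm
  rw [hlog, aeval_apply_of_apply_eq_smul σ.op (h.op_apply i),
    hqS _ (Finset.mem_image_of_mem s (Finset.mem_univ i))]

theorem trace_mul_log [CompleteSpace H] {b : OrthonormalBasis (Fin n) ℂ H}
    (ρ : DensityOperator H) {σ : DensityOperator H} (h : Diagonalizes b σ) :
    Complex.re (LinearMap.trace ℂ H ((ρ.op * CFC.log σ.op : H →L[ℂ] H) : H →ₗ[ℂ] H))
      = ∑ i, outcomeProb b ρ i * Real.log (outcomeProb b σ i) := by
  rw [LinearMap.trace_eq_sum_inner _ b, Complex.re_sum]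
  refine Finset.sum_congr rfl fun i _ => ?_
  rw [ContinuousLinearMap.coe_coe, mul_apply_eq_comp, log_op_basis h, map_smul,
    inner_smul_right, Complex.re_ofReal_mul, mul_comm]
  rfl

theorem quantumRelativeEntropy_eq [CompleteSpace H] {b e : OrthonormalBasis (Fin n) ℂ H}
    {ρ σ : DensityOperator H} (hρ : Diagonalizes b ρ) (hσ : Diagonalizes e σ)
    (hsupp : ∀ v, σ.op v = 0 → ρ.op v = 0) :
    quantumRelativeEntropy ρ σ
      = ((∑ i, outcomeProb b ρ i * Real.log (outcomeProb b ρ i)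
          - ∑ i, outcomeProb e ρ i * Real.log (outcomeProb e σ i) : ℝ) : EReal) := by
  rw [quantumRelativeEntropy, if_pos hsupp, ← trace_mul_log ρ hρ, ← trace_mul_log ρ hσ,
    ContinuousLinearMap.toLinearMap_sub, map_sub, Complex.sub_re]

/-- If the support of `ρ` is not contained in that of `σ`, then `ρ` can yield an outcome that
is impossible according to `σ`. -/
theorem exists_outcomeProb_eq_zero [CompleteSpace H] {b : OrthonormalBasis (Fin n) ℂ H}
    {ρ σ : DensityOperator H} (hσ : Diagonalizes b σ)
    (hsupp : ¬ ∀ v, σ.op v = 0 → ρ.op v = 0) :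
    ∃ i, outcomeProb b σ i = 0 ∧ 0 < outcomeProb b ρ i := by
  by_contra! hcon
  apply hsupp
  intro v hv
  rw [← b.sum_repr' v, map_sum]
  refine Finset.sum_eq_zero fun i _ => ?_
  rw [map_smul]
  by_cases hi : outcomeProb b σ i = 0
  · rw [op_basis_eq_zero b ρ (le_antisymm (hcon i hi) (outcomeProb_nonneg _ _ _)), smul_zero]
  · have h := σ.pos.inner_left_eq_inner_right (b i) v
    rw [hv, inner_zero_right, hσ.op_apply, inner_smul_left, Complex.conj_ofReal] at h
    rw [(mul_eq_zero.1 h).resolve_left (by exact_mod_cast hi), zero_smul]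

/-- With logarithmic payments, misreporting a mixed state costs a multiple of the relative
entropy. -/
theorem expectedReward_sub_eq [CompleteSpace H]
    {g : DensityOperator H → OrthonormalBasis (Fin n) ℂ H} {R : Fin n → ℝ → EReal}
    (hdiag : ∀ σ, Diagonalizes (g σ) σ) {C D : ℝ} (hD : 0 < D)
    (hlog : ∀ i, ∀ x ∈ Ioo (0 : ℝ) 1, R i x = ((C + D * Real.log x : ℝ) : EReal))
    (hzero : ∀ i, R i 0 = ⊥) (ρ σ : DensityOperator H) (hρ : ¬ ρ.IsPure) :
    expectedReward g R ρ ρ - expectedReward g R ρ σ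
      = (D : EReal) * quantumRelativeEntropy ρ σ := by
  have hlt : ∀ (b : OrthonormalBasis (Fin n) ℂ H) i, outcomeProb b ρ i < 1 := fun b i =>
    lt_of_le_of_ne (outcomeProb_le_one b ρ i) fun h => hρ (isPure_of_outcomeProb_eq_one b h)
  have hself : expectedReward g R ρ ρ = ((C + D * ∑ i, outcomeProb (g ρ) ρ i
      * Real.log (outcomeProb (g ρ) ρ i) : ℝ) : EReal) :=
    sum_mul_reward_eq hlog (sum_outcomeProb _ _)
      (fun i hi => ⟨lt_of_le_of_ne (outcomeProb_nonneg _ _ _) hi.symm, hlt _ i⟩) 1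
  by_cases hsupp : ∀ v, σ.op v = 0 → ρ.op v = 0
  · have hcross : expectedReward g R ρ σ = ((C + D * ∑ i, outcomeProb (g σ) ρ i
        * Real.log (outcomeProb (g σ) σ i) : ℝ) : EReal) := by
      have hz : ∀ i, outcomeProb (g σ) σ i = 0 → outcomeProb (g σ) ρ i = 0 := by
        intro i hi
        rw [outcomeProb, hsupp _ (op_basis_eq_zero _ _ hi), inner_zero_right, Complex.zero_re]
      refine sum_mul_reward_eq hlog (sum_outcomeProb _ _) (fun i hi => ⟨?_, ?_⟩) 1
      · exact lt_of_le_of_ne (outcomeProb_nonneg _ _ _) fun h => hi (hz i h.symm)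
      · refine lt_of_le_of_ne (outcomeProb_le_one _ _ _) fun h1 => ?_
        -- If `σ` is pure, then so is `ρ`, whose support is contained in that of `σ`.
        have h2 : ∀ j, j ≠ i → outcomeProb (g σ) ρ j = 0 := fun j hj =>
          hz j (eq_zero_of_sum_eq_one (outcomeProb_mem_stdSimplex _ _) h1 hj)
        have h3 := sum_outcomeProb (g σ) ρ
        rw [Finset.sum_eq_single i (fun j _ hj => h2 j hj) (by simp)] at h3
        exact (hlt (g σ) i).ne h3
    rw [hself, hcross, quantumRelativeEntropy_eq (hdiag ρ) (hdiag σ) hsupp, ← EReal.coe_sub,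
      ← EReal.coe_mul]
    congr 1
    ring
  · obtain ⟨i, hi, hi'⟩ := exists_outcomeProb_eq_zero (hdiag σ) hsupp
    have hcross : expectedReward g R ρ σ = ⊥ := by
      refine EReal.sum_eq_bot (Finset.mem_univ i) ?_
      rw [hi, hzero]
      exact EReal.coe_mul_bot_of_pos hi'
    rw [hself, hcross, quantumRelativeEntropy, if_neg hsupp, EReal.coe_sub_bot,
      EReal.coe_mul_top_of_pos hD]

end RelativeEntropy

theorem theorem2 {H : Type*} [NormedAddCommGroup H] [InnerProductSpace ℂ H]
    [FiniteDimensional ℂ H] [CompleteSpace H]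
    (n : ℕ) (hn : 3 ≤ n) (hdim : Module.finrank ℂ H = n)
    (g : DensityOperator H → OrthonormalBasis (Fin n) ℂ H)
    (R : Fin n → ℝ → EReal)
    (hR : ∀ i, ∀ x ∈ Set.Icc (0 : ℝ) 1, R i x ≠ ⊤)
    (hhonest : ∀ π : DensityOperator H → Equiv.Perm (Fin n), EnsuresHonesty (relabel g π) R) :
    (∀ σ, Diagonalizes (g σ) σ) ∧
    ∃ C D : ℝ, 0 < D ∧
      (∀ i, ∀ x ∈ Set.Ioo (0 : ℝ) 1, R i x = ((C + D * Real.log x : ℝ) : EReal)) ∧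
      (∀ i, R i 0 = ⊥) ∧
      (∀ i, (C : EReal) ≤ R i 1) ∧
      (∀ i, ContinuousWithinAt (R i) (Set.Iio 1) 1 → R i 1 = (C : EReal)) ∧
      (∀ ρ σ : DensityOperator H, ¬ ρ.IsPure →
        expectedReward g R ρ ρ - expectedReward g R ρ σ
          = (D : EReal) * quantumRelativeEntropy ρ σ) := by
  subst hdim
  have e := stdOrthonormalBasis ℂ H
  obtain ⟨C, D, hD, hlog⟩ := exists_reward_eq_log e hn hR hhonest
  have hdiag := diagonalizes_of_reward_eq_log hD hlog hhonest
  have hzero := reward_zero_eq_bot hn (fun i => hR i 0 (by simp)) hdiag hhonest e hD hlog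
  exact ⟨hdiag, C, D, hD, hlog, hzero, le_reward_one hn hdiag hhonest e hlog,
    reward_one_eq hlog, expectedReward_sub_eq hdiag hD hlog hzero⟩
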